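/- Let $n,d\ge 0$ be integers, $A=(a_{mk})\in\mathbb{R}^{n\times d}$, let $Z_1,\dots,Z_d$ be independent real-valued Lévy processes, and let $T=(T_1,\dots,T_d)$ be a $d$-dimensional subordinator (a Lévy process with values in $\mathbb{R}_+^d$ whose trajectories are non-decreasing in each coordinate), independent of $Z=(Z_1,\dots,Z_d)$. Assume that the moment generating functions of $Z_1(1),\dots,Z_d(1)$ and of $T(1)$ are finite in a neighbourhood of the origin. Put $$Y(t)=A\,\bigl(Z_1(T_1(t)),\dots,Z_d(T_d(t))\bigr)^{\top},\qquad t\ge 0 .$$ For a random vector $X$, let $K_X(z)=\log \mathbf E\,e^{\langle z,X\rangle}$ be its cumulant generating function and let $c_i(X)=\partial_z^{\,i}K_X(0)$ be its joint cumulants ($i$ a multi-index); write $K_{Z_k},K_T,K_Y$ and $c_j(Z_k),c_j(T),c_i(Y)$ for those of $Z_k(1),T(1),Y(1)$. A partition $\Lambda\vdash s$ of a multi-index $s\in\mathbb{N}^n$ is a finite multiset of non-zero multi-indices (the columns of $\Lambda$) with sum $s$. If its distinct columns are $\lambda_1,\lambda_2,\dots$ with multiplicities $r_1,r_2,\dots$,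 put $l(\Lambda)=\sum_j r_j$, $\Lambda!=\prod_j(\lambda_j!)^{r_j}$, $\mathfrak m(\Lambda)!=\prod_j r_j!$ and, for a sequence $(g_\lambda)$ indexed by multi-indices, $g_\Lambda=\prod_j g_{\lambda_j}^{r_j}$. With $g_{k,\lambda}=c_{|\lambda|}(Z_k)\prod_{m=1}^n a_{mk}^{\lambda_m}$, let $$\mathfrak B_i(x_1,\dots,x_d)=i!\sum_{s_1+\cdots+s_d=i}\ \sum_{\Lambda_1\vdash s_1,\dots,\Lambda_d\vdash s_d} x_1^{l(\Lambda_1)}\cdots x_d^{l(\Lambda_d)}\,\frac{g_{1,\Lambda_1}\cdots g_{d,\Lambda_d}}{\Lambda_1!\cdots\Lambda_d!\;\mathfrak m(\Lambda_1)!\cdots\mathfrak m(\Lambda_d)!}$$ be the $i$-th generalized complete exponential Bell polynomial, and let $E$ be the linear functional on $\mathbb{R}[x_1,\dots,x_d]$ with $E(x_1^{j_1}\cdots x_d^{j_d})=c_{j}(T)$ for all $j\in\mathbb{N}^d$. Then: 1. The moment generating function of $Y(1)$ is finite in a neighbourhood of the origin. 2. For every $z\in\mathbb{R}^n$ at which the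 right-hand side is defined (that is, all the moment generating functions occurring in it are finite), the moment generating function of $Y(1)$ is finite at $z$ and $$K_Y(z)=K_T\Bigl(K_{Z_1}\bigl(\textstyle\sum_{m}a_{m1}z_m\bigr),\dots,K_{Z_d}\bigl(\sum_{m}a_{md}z_m\bigr)\Bigr).$$ 3. For every $i\in\mathbb{N}^n$, $c_i(Y)=E\bigl(\mathfrak B_i(x_1,\dots,x_d)\bigr)$; that is, $c_i(Y)$ is obtained from $\mathfrak B_i$ by replacing each monomial $x_1^{j_1}\cdots x_d^{j_d}$ by $c_j(T)$. -/

import Mathlib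

open MeasureTheory ProbabilityTheory Filter
open scoped NNReal Topology Nat

noncomputable section

namespace SubLevy

/-! ### Lévy processes and subordinators -/

/-- An `E`-valued Lévy process `(X t)`, `t ≥ 0`: it starts at `0`, has independent and stationary
increments, is stochastically continuous, and almost all of its paths are right-continuous with
left limits. -/
structure IsLevyProcess {Ω E : Type*} [MeasurableSpace Ω] [NormedAddCommGroup E]
    [MeasurableSpace E] (X : ℝ≥0 → Ω → E) (P : Measure Ω) : Prop where
  measurable : ∀ t, Measurable (X t)
  start_zero : ∀ᵐ ω ∂P, X 0 ω = 0
  indep_increments : HasIndepIncrements X P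
  stationary_increments : ∀ s t, IdentDistrib (X (s + t) - X s) (X t - X 0) P P
  stoch_continuous : ∀ t, TendstoInMeasure P X (𝓝 t) (X t)
  cadlag : ∀ᵐ ω ∂P, ∀ t : ℝ≥0,
    ContinuousWithinAt (fun r => X r ω) (Set.Ici t) t ∧
      ∃ l : E, Tendsto (fun r => X r ω) (𝓝[<] t) (𝓝 l)

/-- A `d`-dimensional subordinator: a Lévy process in `ℝ^d` whose trajectories are increasing in
each coordinate (hence, starting at `0`, they stay in the nonnegative orthant). -/
structure IsSubordinator {Ω : Type*} [MeasurableSpace Ω] {d : ℕ}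
    (T : ℝ≥0 → Ω → (Fin d → ℝ)) (P : Measure Ω) : Prop where
  isLevy : IsLevyProcess T P
  increasing : ∀ᵐ ω ∂P, ∀ k, Monotone (fun t => T t ω k)

/-- The subordinated process `Y(t) = A (Z₁(T₁(t)), …, Z_d(T_d(t)))ᵀ`. The coordinates of a
subordinator are almost surely nonnegative, so `Real.toNNReal` only changes the type. -/
def subordinated {Ω : Type*} {n d : ℕ} (A : Matrix (Fin n) (Fin d) ℝ)
    (Z : Fin d → ℝ≥0 → Ω → ℝ) (T : ℝ≥0 → Ω → (Fin d → ℝ)) :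
    ℝ≥0 → Ω → (Fin n → ℝ) :=
  fun t ω => A.mulVec (fun k => Z k (T t ω k).toNNReal ω)

/-! ### Cumulant generating functions and cumulants -/

/-- The moment generating function of the random vector `X` is finite at `z`. -/
def FiniteMGFAt {Ω : Type*} [MeasurableSpace Ω] {n : ℕ} (X : Ω → (Fin n → ℝ)) (P : Measure Ω)
    (z : Fin n → ℝ) : Prop :=
  Integrable (fun ω => Real.exp (∑ m, z m * X ω m)) P

/-- The joint cumulant generating function `K_X(z) = log E[exp(∑ z_m X_m)]`. -/
def jointCgf {Ω : Type*} [MeasurableSpace Ω] {n : ℕ} (X : Ω → (Fin n → ℝ)) (P : Measure Ω)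
    (z : Fin n → ℝ) : ℝ :=
  Real.log (∫ ω, Real.exp (∑ m, z m * X ω m) ∂P)

/-- The partial derivative of `f` in the `m`-th coordinate. -/
def partialDeriv {n : ℕ} (m : Fin n) (f : (Fin n → ℝ) → ℝ) : (Fin n → ℝ) → ℝ :=
  fun z => lineDeriv ℝ f z (Pi.single m 1)

/-- The mixed partial derivative `∂₁^{i₁} ⋯ ∂ₙ^{iₙ} f`. -/
def mixedPartial {n : ℕ} (i : Fin n →₀ ℕ) (f : (Fin n → ℝ) → ℝ) : (Fin n → ℝ) → ℝ :=
  (List.finRange n).foldr (fun m h => (partialDeriv m)^[i m] h) f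

/-- The joint cumulant `c_i(X)`: the coefficient of `z^i / i!` in the Taylor expansion of `K_X`
at `0`. -/
def jointCumulant {Ω : Type*} [MeasurableSpace Ω] {n : ℕ} (X : Ω → (Fin n → ℝ)) (P : Measure Ω)
    (i : Fin n →₀ ℕ) : ℝ :=
  mixedPartial i (jointCgf X P) 0

/-- The `m`-th cumulant of a real random variable. -/
def cumulant {Ω : Type*} [MeasurableSpace Ω] (X : Ω → ℝ) (P : Measure Ω) (m : ℕ) : ℝ :=
  iteratedDeriv m (cgf X P) 0

/-! ### Multi-index partitions -/

/-- The factorial `i! = i₁! ⋯ iₙ!` of a multi-index. -/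
def multiFactorial {n : ℕ} (i : Fin n →₀ ℕ) : ℕ := ∏ m, (i m)!

/-- A partition of the multi-index `i`: a matrix of nonnegative integers without zero columns,
whose columns are taken up to order (equivalently, in lexicographic order) and sum to `i`. It is
recorded as the multiset of its columns. -/
@[ext] structure MultiPartition {n : ℕ} (i : Fin n →₀ ℕ) where
  cols : Multiset (Fin n →₀ ℕ)
  ne_zero : ∀ c ∈ cols, c ≠ 0
  sum_eq : cols.sum = i

namespace MultiPartition

theorem degree_sum_ge {n : ℕ} (M : Multiset (Fin n →₀ ℕ)) (h : ∀ c ∈ M, c ≠ 0) :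
    M.card ≤ M.sum.degree := by
  induction M using Multiset.induction_on with
  | empty => simp
  | cons a M ih =>
    have h1 := ih (fun c hc => h c (Multiset.mem_cons_of_mem hc))
    have h2 : a.degree ≠ 0 := by
      rw [Ne, Finsupp.degree_eq_zero_iff]
      exact h a (Multiset.mem_cons_self a M)
    rw [Multiset.card_cons, Multiset.sum_cons, map_add]
    omega

instance instFinite {n : ℕ} (i : Fin n →₀ ℕ) : Finite (MultiPartition i) := by
  classical
  let S : Finset (Multiset (Fin n →₀ ℕ)) :=
    (Multiset.powerset (i.degree • (Finset.Iic i).val)).toFinset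
  refine Finite.of_injective
    (fun L : MultiPartition i => (⟨L.cols, ?_⟩ : {M // M ∈ S})) ?_
  · rw [Multiset.mem_toFinset, Multiset.mem_powerset, Multiset.le_iff_count]
    intro c
    by_cases hc : c ∈ L.cols
    · have h1 : c ∈ (Finset.Iic i).val := by
        rw [Finset.mem_val, Finset.mem_Iic, ← L.sum_eq]
        exact Multiset.single_le_sum (fun _ _ => zero_le) c hc
      rw [Multiset.count_nsmul, Multiset.count_eq_one_of_mem (Finset.Iic i).nodup h1, mul_one]
      have h2 := degree_sum_ge L.cols L.ne_zero
      rw [L.sum_eq] at h2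
      exact (Multiset.count_le_card c L.cols).trans h2
    · rw [Multiset.count_eq_zero_of_notMem hc]
      exact Nat.zero_le _
  · intro L L' h
    exact MultiPartition.ext (congrArg Subtype.val h)

instance instFintype {n : ℕ} (i : Fin n →₀ ℕ) : Fintype (MultiPartition i) :=
  Fintype.ofFinite _

variable {n : ℕ} {i : Fin n →₀ ℕ}

/-- The number `l(Λ)` of columns. -/
def length (L : MultiPartition i) : ℕ := L.cols.card

/-- `Λ!`, the product of the factorials of all columns, counted with multiplicity. -/
def factorial (L : MultiPartition i) : ℕ := (L.cols.map multiFactorial).prod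

/-- `𝔪(Λ)!`, the product of the factorials of the multiplicities of the distinct columns. -/
def multFactorial (L : MultiPartition i) : ℕ :=
  ∏ c ∈ L.cols.toFinset, (L.cols.count c)!

/-- The product `g_Λ` associated to the multi-indexed sequence `g` through `Λ`. -/
def assoc (L : MultiPartition i) (g : (Fin n →₀ ℕ) → ℝ) : ℝ := (L.cols.map g).prod

end MultiPartition

/-! ### Generalized Bell polynomials and umbral evaluation -/

/-- The `i`-th generalized complete exponential Bell polynomial in the indeterminates
`x₁, …, x_d`, built from the multi-indexed sequences `g₁, …, g_d`. The sum runs over all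
`s₁ + ⋯ + s_d = i` and all partitions of `s₁, …, s_d`. -/
def bellPolynomial {n d : ℕ} (g : Fin d → (Fin n →₀ ℕ) → ℝ) (i : Fin n →₀ ℕ) :
    MvPolynomial (Fin d) ℝ :=
  MvPolynomial.C (multiFactorial i : ℝ) *
    ∑ s ∈ Finset.piAntidiag (Finset.univ : Finset (Fin d)) i,
      ∑ L : (∀ k, MultiPartition (s k)),
        (∏ k, MvPolynomial.X k ^ (L k).length) *
          MvPolynomial.C ((∏ k, (L k).assoc (g k)) /
            ((∏ k, ((L k).factorial : ℝ)) * ∏ k, ((L k).multFactorial : ℝ)))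

/-- The linear operator on polynomials in `x₁, …, x_d` that sends the monomial
`x₁^{j₁} ⋯ x_d^{j_d}` to the joint cumulant `c_j(T)`. -/
def umbralEval {Ω : Type*} [MeasurableSpace Ω] {d : ℕ} (T : Ω → (Fin d → ℝ)) (P : Measure Ω) :
    MvPolynomial (Fin d) ℝ →ₗ[ℝ] ℝ :=
  (MvPolynomial.basisMonomials (Fin d) ℝ).constr ℝ (fun j => jointCumulant T P j)

/-- The sequences `g_{k,λ} = c_{|λ|}(Z_k) (a_{·k})^λ`, where `a_{·k}` is the `k`-th column
of `A`. -/
def cumulantSeq {Ω : Type*} [MeasurableSpace Ω] {n d : ℕ} (A : Matrix (Fin n) (Fin d) ℝ)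
    (Z : Fin d → Ω → ℝ) (P : Measure Ω) (k : Fin d) (l : Fin n →₀ ℕ) : ℝ :=
  cumulant (Z k) P l.degree * ∏ m, A m k ^ l m

end SubLevy

end

/-!
Independence and stationarity of the increments make `t ↦ E exp (u Z_k(t))` multiplicative, and
right-continuity of the paths makes it, by Fatou's lemma, lower semicontinuous from the right; hence
it equals `exp (t K_{Z_k}(u))`. Conditioning on `T(1)`, which is independent of `Z`, then gives
`K_Y = K_T ∘ g` with `g_k(z) = K_{Z_k}(⟨a_k, z⟩)`.

Cumulant generating functions are analytic at `0`, so the cumulants of `Y` are the derivatives of a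
composition. A derivative of order `i` only depends on the Taylor polynomials of degree `|i|`, and
the coefficients of a composition of polynomials are computed by expanding
`∏_k exp (x_k ∑_λ g_{k,λ} z^λ / λ!)`: grouping the products of its terms by the multiset of their
exponents gives a sum over multi-index partitions, which is the Bell polynomial.
-/

noncomputable section

namespace SubLevy

section PartialDerivatives

open scoped ContDiff

variable {n : ℕ} {f g : (Fin n → ℝ) → ℝ} {p : Fin n → ℝ}

theorem partialDeriv_eventuallyEq (h : f =ᶠ[𝓝 p] g) (m : Fin n) :
    partialDeriv m f =ᶠ[𝓝 p] partialDeriv m g := by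
  filter_upwards [h.eventuallyEq_nhds] with z hz
  exact hz.lineDeriv_eq

theorem eventually_differentiableAt {E F : Type*} [NormedAddCommGroup E] [NormedSpace ℝ E]
    [NormedAddCommGroup F] [NormedSpace ℝ F] {f : E → F} {p : E}
    (hf : ContDiffAt ℝ 1 f p) : ∀ᶠ z in 𝓝 p, DifferentiableAt ℝ f z := by
  filter_upwards [hf.eventually (by simp)] with z hz
  exact hz.differentiableAt one_ne_zero

theorem partialDeriv_eventuallyEq_fderiv (hf : ContDiffAt ℝ 1 f p) (m : Fin n) :
    partialDeriv m f =ᶠ[𝓝 p] fun z => fderiv ℝ f z (Pi.single m 1) := by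
  filter_upwards [eventually_differentiableAt hf] with z hz
  exact hz.lineDeriv_eq_fderiv

theorem contDiffAt_partialDeriv (hf : ContDiffAt ℝ ∞ f p) (m : Fin n) :
    ContDiffAt ℝ ∞ (partialDeriv m f) p :=
  ((hf.fderiv_right (m := ∞) (by simp)).clm_apply contDiffAt_const).congr_of_eventuallyEq
    (partialDeriv_eventuallyEq_fderiv (hf.of_le (by simp)) m)

theorem partialDeriv_partialDeriv_eventuallyEq (hf : ContDiffAt ℝ 2 f p) (m k : Fin n) :
    partialDeriv m (partialDeriv k f) =ᶠ[𝓝 p]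
      fun z => fderiv ℝ (fderiv ℝ f) z (Pi.single m 1) (Pi.single k 1) := by
  have hf' : ContDiffAt ℝ 1 (fderiv ℝ f) p := hf.fderiv_right (by norm_num)
  refine (partialDeriv_eventuallyEq
    (partialDeriv_eventuallyEq_fderiv (hf.of_le one_le_two) k) m).trans ?_
  filter_upwards [eventually_differentiableAt hf'] with z hz
  have hderiv := hz.hasFDerivAt.clm_apply (hasFDerivAt_const (Pi.single k (1 : ℝ)) z)
  rw [partialDeriv, hderiv.differentiableAt.lineDeriv_eq_fderiv, hderiv.fderiv]
  simp

theorem partialDeriv_comm (hf : ContDiffAt ℝ 2 f p) (m k : Fin n) :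
    partialDeriv m (partialDeriv k f) =ᶠ[𝓝 p] partialDeriv k (partialDeriv m f) := by
  refine (partialDeriv_partialDeriv_eventuallyEq hf m k).trans
    (EventuallyEq.trans ?_ (partialDeriv_partialDeriv_eventuallyEq hf k m).symm)
  filter_upwards [hf.eventually (by simp)] with z hz
  exact hz.isSymmSndFDerivAt (by simp) _ _

/-- The iterated partial derivative along a word of coordinate indices, the last letter acting
first. It interpolates between `mixedPartial`, where the letters are sorted, and the iterated
Fréchet derivative evaluated at coordinate vectors. -/
def wordDeriv (w : List (Fin n)) (f : (Fin n → ℝ) → ℝ) : (Fin n → ℝ) → ℝ :=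
  w.foldr partialDeriv f

theorem contDiffAt_wordDeriv (hf : ContDiffAt ℝ ∞ f p) (w : List (Fin n)) :
    ContDiffAt ℝ ∞ (wordDeriv w f) p := by
  induction w with
  | nil => exact hf
  | cons m w ih => exact contDiffAt_partialDeriv ih m

theorem wordDeriv_perm (hf : ContDiffAt ℝ ∞ f p) {w w' : List (Fin n)} (h : w.Perm w') :
    wordDeriv w f =ᶠ[𝓝 p] wordDeriv w' f := by
  induction h with
  | nil => rfl
  | cons m _ ih => exact partialDeriv_eventuallyEq ih m
  | swap m k w =>
    exact partialDeriv_comm ((contDiffAt_wordDeriv hf w).of_le (WithTop.coe_le_coe.2 le_top)) k m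
  | trans _ _ ih₁ ih₂ => exact ih₁.trans ih₂

theorem wordDeriv_ofFn (hf : ContDiffAt ℝ ∞ f p) {N : ℕ} (v : Fin N → Fin n) :
    wordDeriv (List.ofFn v) f =ᶠ[𝓝 p]
      fun z => iteratedFDeriv ℝ N f z (fun j => Pi.single (v j) 1) := by
  induction N with
  | zero => exact .of_eq (by ext; simp [wordDeriv])
  | succ N ih =>
    have hN : ContDiffAt ℝ 1 (iteratedFDeriv ℝ N f) p :=
      hf.iteratedFDeriv_right (mod_cast le_top)
    have hcons : wordDeriv (List.ofFn v) f =
        partialDeriv (v 0) (wordDeriv (List.ofFn fun j => v j.succ) f) := by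
      simp [wordDeriv, List.ofFn_succ]
    rw [hcons]
    refine (partialDeriv_eventuallyEq (ih _) (v 0)).trans ?_
    filter_upwards [eventually_differentiableAt hN] with z hz
    rw [hz.iteratedFDeriv_succ_apply_left', partialDeriv,
      DifferentiableAt.lineDeriv_eq_fderiv]
    · rfl
    · exact hz.continuousMultilinear_apply_const _

theorem mixedPartial_eq_wordDeriv (i : Fin n →₀ ℕ) (f : (Fin n → ℝ) → ℝ) :
    mixedPartial i f =
      wordDeriv ((List.finRange n).flatMap fun m => List.replicate (i m) m) f := by
  unfold mixedPartial wordDeriv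
  induction List.finRange n with
  | nil => rfl
  | cons m l ih =>
    rw [List.foldr_cons, List.flatMap_cons, List.foldr_append, ih]
    generalize List.foldr partialDeriv f (List.flatMap _ l) = h
    induction i m with
    | zero => rfl
    | succ r ihr => rw [Function.iterate_succ_apply', ihr]; rfl

theorem coe_flatMap_replicate (i : Fin n →₀ ℕ) :
    (((List.finRange n).flatMap fun m => List.replicate (i m) m : List (Fin n)) :
      Multiset (Fin n)) = i.toMultiset := by
  ext m
  rw [Multiset.coe_count, List.count_flatMap, Finsupp.count_toMultiset, ← List.ofFn_eq_map,
    List.sum_ofFn]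
  simp [List.count_replicate]

theorem toMultiset_sum_single_one {N : ℕ} (v : Fin N → Fin n) :
    (∑ j, Finsupp.single (v j) 1 : Fin n →₀ ℕ).toMultiset = (List.ofFn v : Multiset (Fin n)) := by
  induction N with
  | zero => simp
  | succ N ih =>
    rw [Fin.sum_univ_succ, map_add, ih, List.ofFn_succ, ← Multiset.cons_coe]
    simp

theorem exists_eq_sum_single (i : Fin n →₀ ℕ) :
    ∃ (N : ℕ) (v : Fin N → Fin n), i = ∑ j, Finsupp.single (v j) 1 := by
  refine ⟨_, i.toMultiset.toList.get, Finsupp.orderIsoMultiset.injective ?_⟩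
  rw [Finsupp.coe_orderIsoMultiset, toMultiset_sum_single_one, List.ofFn_get, Multiset.coe_toList]

theorem degree_sum_single {N : ℕ} (v : Fin N → Fin n) :
    (∑ j, Finsupp.single (v j) 1 : Fin n →₀ ℕ).degree = N := by
  simp

theorem mixedPartial_sum_single (hf : ContDiffAt ℝ ∞ f p) {N : ℕ} (v : Fin N → Fin n) :
    mixedPartial (∑ j, Finsupp.single (v j) 1) f p =
      iteratedFDeriv ℝ N f p (fun j => Pi.single (v j) 1) := by
  rw [mixedPartial_eq_wordDeriv, ← (wordDeriv_ofFn hf v).eq_of_nhds]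
  refine (wordDeriv_perm hf (Multiset.coe_eq_coe.1 ?_)).eq_of_nhds
  rw [coe_flatMap_replicate, toMultiset_sum_single_one]

end PartialDerivatives

section Composition

open scoped ContDiff

variable {n d : ℕ}

theorem iteratedFDeriv_eq_of_mixedPartial_eq {f f' : (Fin n → ℝ) → ℝ} {p : Fin n → ℝ}
    (hf : ContDiffAt ℝ ∞ f p) (hf' : ContDiffAt ℝ ∞ f' p) {N : ℕ}
    (h : ∀ i : Fin n →₀ ℕ, i.degree = N → mixedPartial i f p = mixedPartial i f' p) :
    iteratedFDeriv ℝ N f p = iteratedFDeriv ℝ N f' p := by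
  refine ContinuousMultilinearMap.toMultilinearMap_injective <|
    Module.Basis.ext_multilinear (fun _ => Pi.basisFun ℝ (Fin n)) fun v => ?_
  simp only [Pi.basisFun_apply]
  exact (mixedPartial_sum_single hf v).symm.trans
    ((h _ (by simp)).trans (mixedPartial_sum_single hf' v))

theorem iteratedFDeriv_apply_apply {g : (Fin n → ℝ) → (Fin d → ℝ)} {p : Fin n → ℝ} {N : ℕ}
    (hg : ContDiffAt ℝ N g p) (v : Fin N → Fin n → ℝ) (k : Fin d) :
    iteratedFDeriv ℝ N g p v k = iteratedFDeriv ℝ N (fun z => g z k) p v :=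
  (DFunLike.congr_fun ((ContinuousLinearMap.proj k :
    (Fin d → ℝ) →L[ℝ] ℝ).iteratedFDeriv_comp_left hg le_rfl) v).symm

theorem iteratedFDeriv_eq_of_forall_mixedPartial_eq {g g' : (Fin n → ℝ) → (Fin d → ℝ)}
    {p : Fin n → ℝ} (hg : ContDiffAt ℝ ∞ g p) (hg' : ContDiffAt ℝ ∞ g' p) {N : ℕ}
    (h : ∀ k, ∀ i : Fin n →₀ ℕ, i.degree = N →
      mixedPartial i (fun z => g z k) p = mixedPartial i (fun z => g' z k) p) :
    iteratedFDeriv ℝ N g p = iteratedFDeriv ℝ N g' p := by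
  ext v k
  rw [iteratedFDeriv_apply_apply (hg.of_le (mod_cast le_top)),
    iteratedFDeriv_apply_apply (hg'.of_le (mod_cast le_top)),
    iteratedFDeriv_eq_of_mixedPartial_eq (contDiffAt_pi.1 hg k) (contDiffAt_pi.1 hg' k) (h k)]

/-- The Faà di Bruno formula expresses a derivative of a composition through derivatives of the
same or smaller order of the two factors. -/
theorem mixedPartial_comp_congr {f f' : (Fin d → ℝ) → ℝ} {g g' : (Fin n → ℝ) → (Fin d → ℝ)}
    {p : Fin n → ℝ} {q : Fin d → ℝ} (hf : ContDiffAt ℝ ∞ f q) (hf' : ContDiffAt ℝ ∞ f' q)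
    (hg : ContDiffAt ℝ ∞ g p) (hg' : ContDiffAt ℝ ∞ g' p) (hq : g p = q) (hq' : g' p = q)
    (i : Fin n →₀ ℕ)
    (hff' : ∀ j : Fin d →₀ ℕ, j.degree ≤ i.degree → mixedPartial j f q = mixedPartial j f' q)
    (hgg' : ∀ k, ∀ l : Fin n →₀ ℕ, l.degree ≤ i.degree →
      mixedPartial l (fun z => g z k) p = mixedPartial l (fun z => g' z k) p) :
    mixedPartial i (f ∘ g) p = mixedPartial i (f' ∘ g') p := by
  subst hq
  obtain ⟨N, v, rfl⟩ := exists_eq_sum_single i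
  rw [degree_sum_single] at hff' hgg'
  suffices iteratedFDeriv ℝ N (f ∘ g) p = iteratedFDeriv ℝ N (f' ∘ g') p by
    rw [mixedPartial_sum_single (hf.comp p hg),
      mixedPartial_sum_single (ContDiffAt.comp p (hq'.symm ▸ hf') hg'), this]
  rw [iteratedFDeriv_comp hf hg (mod_cast le_top),
    iteratedFDeriv_comp (hq'.symm ▸ hf') hg' (mod_cast le_top), hq']
  refine Finset.sum_congr rfl fun c _ => ?_
  have hfc : iteratedFDeriv ℝ c.length f (g p) = iteratedFDeriv ℝ c.length f' (g p) :=
    iteratedFDeriv_eq_of_mixedPartial_eq hf hf' fun j hj => hff' j (hj.trans_le c.length_le)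
  have hgc (b : Fin c.length) :
      iteratedFDeriv ℝ (c.partSize b) g p = iteratedFDeriv ℝ (c.partSize b) g' p :=
    iteratedFDeriv_eq_of_forall_mixedPartial_eq hg hg' fun k l hl =>
      hgg' k l (hl.trans_le (c.partSize_le b))
  simp only [FormalMultilinearSeries.compAlongOrderedFinpartition, ftaylorSeries, hfc, hgc]

theorem iteratedFDeriv_comp_continuousLinearMap {E F G : Type*} [NormedAddCommGroup E]
    [NormedSpace ℝ E] [NormedAddCommGroup F] [NormedSpace ℝ F] [NormedAddCommGroup G]
    [NormedSpace ℝ G] {h : F → G} (L : E →L[ℝ] F) {x : E} {N : ℕ}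
    (hh : ContDiffAt ℝ N h (L x)) :
    iteratedFDeriv ℝ N (h ∘ L) x =
      (iteratedFDeriv ℝ N h (L x)).compContinuousLinearMap fun _ => L := by
  obtain ⟨U, hU, hxU, hhU⟩ := hh.contDiffOn' le_rfl (by simp)
  rw [Set.insert_eq_of_mem (Set.mem_univ _), Set.univ_inter] at hhU
  have hLU : IsOpen (L ⁻¹' U) := hU.preimage L.continuous
  rw [← iteratedFDerivWithin_of_isOpen N hLU hxU, ← iteratedFDerivWithin_of_isOpen N hU hxU,
    L.iteratedFDerivWithin_comp_right hhU hU.uniqueDiffOn hLU.uniqueDiffOn hxU le_rfl]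

theorem mixedPartial_comp_linear {h : ℝ → ℝ} {a p : Fin n → ℝ}
    (hh : ContDiffAt ℝ ∞ h (∑ m, a m * p m)) (l : Fin n →₀ ℕ) :
    mixedPartial l (fun z => h (∑ m, a m * z m)) p =
      iteratedDeriv l.degree h (∑ m, a m * p m) * ∏ m, a m ^ l m := by
  let L : (Fin n → ℝ) →L[ℝ] ℝ := ∑ m, a m • ContinuousLinearMap.proj m
  have hL (z : Fin n → ℝ) : L z = ∑ m, a m * z m := by simp [L]
  have hcomp : (fun z => h (∑ m, a m * z m)) = h ∘ L := by ext; simp [hL]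
  rw [← hL] at hh ⊢
  obtain ⟨N, v, rfl⟩ := exists_eq_sum_single l
  have hprod : ∏ m, a m ^ (∑ j, Finsupp.single (v j) 1 : Fin n →₀ ℕ) m = ∏ j, a (v j) := by
    simp only [Finsupp.coe_finsetSum, Finset.sum_apply, ← Finset.prod_pow_eq_pow_sum]
    rw [Finset.prod_comm]
    simp [Finsupp.single_apply, pow_ite, Finset.prod_ite_eq]
  rw [hprod, hcomp, degree_sum_single, mixedPartial_sum_single (hh.comp p L.contDiff.contDiffAt),
    iteratedFDeriv_comp_continuousLinearMap L (hh.of_le (mod_cast le_top)),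
    ContinuousMultilinearMap.compContinuousLinearMap_apply,
    iteratedFDeriv_apply_eq_iteratedDeriv_mul_prod, smul_eq_mul, mul_comm]
  congr! 2 with j
  simp [hL, Pi.single_apply]

end Composition

section PolynomialFunctions

open scoped ContDiff

variable {n : ℕ}

theorem contDiff_eval_sub (p : Fin n → ℝ) (q : MvPolynomial (Fin n) ℝ) :
    ContDiff ℝ ∞ fun z => MvPolynomial.eval (z - p) q := by
  induction q using MvPolynomial.induction_on with
  | C a => simpa using contDiff_const
  | add q r hq hr => simpa using hq.add hr
  | mul_X q k hq => simpa using hq.mul ((contDiff_apply ℝ ℝ k).sub contDiff_const)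

theorem hasLineDerivAt_eval_sub (p z : Fin n → ℝ) (m : Fin n) (q : MvPolynomial (Fin n) ℝ) :
    HasLineDerivAt ℝ (fun z => MvPolynomial.eval (z - p) q)
      (MvPolynomial.eval (z - p) (MvPolynomial.pderiv m q)) z (Pi.single m 1) := by
  induction q using MvPolynomial.induction_on with
  | C a => simpa [HasLineDerivAt] using hasDerivAt_const (0 : ℝ) a
  | add q r hq hr =>
    simp only [map_add]
    exact HasDerivAt.add hq hr
  | mul_X q k hq =>
    have hX : HasLineDerivAt ℝ (fun z : Fin n → ℝ => (z - p) k) ((Pi.single m 1 : Fin n → ℝ) k) z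
        (Pi.single m 1) :=
      ((hasFDerivAt_apply (𝕜 := ℝ) k z).sub_const (p k)).hasLineDerivAt _
    have hqX := HasDerivAt.mul hq hX
    simp only [zero_smul, add_zero] at hqX
    refine (hqX.congr_deriv ?_).congr_of_eventuallyEq (.of_eq ?_)
    · by_cases hmk : m = k <;> simp [MvPolynomial.pderiv_X, hmk, Ne.symm, mul_comm, add_comm]
    · ext t; simp

theorem wordDeriv_eval_sub (p : Fin n → ℝ) (w : List (Fin n)) (q : MvPolynomial (Fin n) ℝ) :
    wordDeriv w (fun z => MvPolynomial.eval (z - p) q) =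
      fun z => MvPolynomial.eval (z - p) (w.foldr (fun m r => MvPolynomial.pderiv m r) q) := by
  induction w with
  | nil => rfl
  | cons m w ih =>
    change partialDeriv m (wordDeriv w _) = _
    rw [ih]
    exact funext fun z => (hasLineDerivAt_eval_sub p z m _).lineDeriv

theorem multiFactorial_add_single (j : Fin n →₀ ℕ) (m : Fin n) :
    multiFactorial (j + Finsupp.single m 1) = (j m + 1) * multiFactorial j := by
  unfold multiFactorial
  rw [← Finset.mul_prod_erase _ _ (Finset.mem_univ m),
    ← Finset.mul_prod_erase _ (fun k => (j k)!) (Finset.mem_univ m), ← mul_assoc]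
  congr 1
  · simp [Nat.factorial_succ]
  · refine Finset.prod_congr rfl fun k hk => ?_
    simp [(Finset.ne_of_mem_erase hk).symm]

theorem multiFactorial_mul_coeff_foldr_pderiv (w : List (Fin n)) (q : MvPolynomial (Fin n) ℝ)
    (j : Fin n →₀ ℕ) :
    multiFactorial j * (w.foldr (fun m r => MvPolynomial.pderiv m r) q).coeff j =
      multiFactorial (j + Multiset.toFinsupp (w : Multiset (Fin n))) *
        q.coeff (j + Multiset.toFinsupp (w : Multiset (Fin n))) := by
  induction w generalizing j with
  | nil => simp
  | cons m w ih =>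
    have hcons : j + Multiset.toFinsupp ((m :: w : List (Fin n)) : Multiset (Fin n)) =
        j + Finsupp.single m 1 + Multiset.toFinsupp (w : Multiset (Fin n)) := by
      rw [← Multiset.cons_coe, ← Multiset.singleton_add, map_add, Multiset.toFinsupp_singleton,
        add_assoc]
    rw [hcons, ← ih, List.foldr_cons, MvPolynomial.coeff_pderiv, multiFactorial_add_single]
    push_cast
    ring

theorem mixedPartial_eval_sub_self (i : Fin n →₀ ℕ) (p : Fin n → ℝ)
    (q : MvPolynomial (Fin n) ℝ) :
    mixedPartial i (fun z => MvPolynomial.eval (z - p) q) p = multiFactorial i * q.coeff i := by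
  have hcoeff := multiFactorial_mul_coeff_foldr_pderiv
    ((List.finRange n).flatMap fun m => List.replicate (i m) m) q 0
  rw [coe_flatMap_replicate, Finsupp.toMultiset_toFinsupp, zero_add] at hcoeff
  rw [mixedPartial_eq_wordDeriv, wordDeriv_eval_sub, ← hcoeff]
  simp [multiFactorial, MvPolynomial.constantCoeff_eq]

end PolynomialFunctions

section BellPolynomials

variable {n d : ℕ}

theorem multiFactorial_ne_zero (j : Fin n →₀ ℕ) : multiFactorial j ≠ 0 :=
  Finset.prod_ne_zero_iff.2 fun _ _ => Nat.factorial_ne_zero _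

/-- The exponential generating polynomial `∑ c_j z^j / j!` of the sequence `c`, truncated to the
multi-indices `j ∈ S`. -/
def taylorPoly (S : Finset (Fin n →₀ ℕ)) (c : (Fin n →₀ ℕ) → ℝ) : MvPolynomial (Fin n) ℝ :=
  ∑ j ∈ S, MvPolynomial.monomial j (c j / multiFactorial j)

theorem multiFactorial_mul_coeff_taylorPoly {S : Finset (Fin n →₀ ℕ)} (c : (Fin n →₀ ℕ) → ℝ)
    {j : Fin n →₀ ℕ} (hj : j ∈ S) : multiFactorial j * (taylorPoly S c).coeff j = c j := by
  have := multiFactorial_ne_zero j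
  simp only [taylorPoly, MvPolynomial.coeff_sum, MvPolynomial.coeff_monomial,
    Finset.sum_ite_eq', hj, if_true]
  field_simp

theorem prod_map_monomial {σ R : Type*} [CommSemiring R] (M : Multiset (σ →₀ ℕ))
    (b : (σ →₀ ℕ) → R) :
    (M.map fun l => MvPolynomial.monomial l (b l)).prod =
      MvPolynomial.monomial M.sum (M.map b).prod := by
  induction M using Multiset.induction_on with
  | empty => simp
  | cons a M ih =>
    rw [Multiset.map_cons, Multiset.prod_cons, ih, Multiset.sum_cons, Multiset.map_cons,
      Multiset.prod_cons, MvPolynomial.monomial_mul]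

theorem countPerms_mul_prod_factorial_count {α : Type*} [DecidableEq α] (M : Multiset α) :
    M.countPerms * ∏ c ∈ M.toFinset, (M.count c)! = (M.card)! := by
  have h := Nat.multinomial_spec M.toFinset (fun c => M.count c)
  rw [Multiset.toFinset_sum_count_eq] at h
  rw [← h, mul_comm]
  rfl

namespace MultiPartition

variable {s : Fin n →₀ ℕ}

/-- The weight `c_Λ / (Λ! 𝔪(Λ)!)` with which the partition `Λ` enters the Bell polynomial of the
sequence `c`. -/
def weight (L : MultiPartition s) (c : (Fin n →₀ ℕ) → ℝ) : ℝ :=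
  L.assoc c / (L.factorial * L.multFactorial)

theorem length_le_degree (L : MultiPartition s) : L.length ≤ s.degree :=
  (degree_sum_ge L.cols L.ne_zero).trans_eq (congrArg _ L.sum_eq)

theorem le_of_mem_cols (L : MultiPartition s) {l : Fin n →₀ ℕ} (hl : l ∈ L.cols) : l ≤ s :=
  (Multiset.single_le_sum (fun _ _ => zero_le) l hl).trans_eq L.sum_eq

theorem factorial_length_mul_weight (L : MultiPartition s) (c : (Fin n →₀ ℕ) → ℝ) :
    L.length ! * L.weight c =
      L.cols.countPerms * (L.cols.map fun l => c l / multiFactorial l).prod := by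
  classical
  have hcount : (L.length ! : ℝ) = L.cols.countPerms * L.multFactorial := by
    rw [length, multFactorial, ← countPerms_mul_prod_factorial_count]
    push_cast
    congr!
  have hfact : (L.factorial : ℝ) = (L.cols.map fun l => (multiFactorial l : ℝ)).prod := by
    rw [factorial, Nat.cast_multiset_prod, Multiset.map_map]
    rfl
  have hmult : (L.multFactorial : ℝ) ≠ 0 :=
    Nat.cast_ne_zero.2 (Finset.prod_ne_zero_iff.2 fun _ _ => Nat.factorial_ne_zero _)
  rw [weight, hcount, Multiset.prod_map_div, ← hfact, assoc]
  field_simp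

end MultiPartition

theorem coeff_countPerms_mul_prod_map_monomial {σ : Type*} [DecidableEq σ]
    (M : Multiset (σ →₀ ℕ)) (b : (σ →₀ ℕ) → ℝ) (s : σ →₀ ℕ) :
    ((M.countPerms : MvPolynomial σ ℝ) *
        (M.map fun l => MvPolynomial.monomial l (b l)).prod).coeff s =
      if M.sum = s then M.countPerms * (M.map b).prod else 0 := by
  rw [prod_map_monomial, ← map_natCast (MvPolynomial.C (σ := σ) (R := ℝ)),
    MvPolynomial.coeff_C_mul, MvPolynomial.coeff_monomial, mul_ite, mul_zero]

theorem coeff_taylorPoly_pow {S : Finset (Fin n →₀ ℕ)} (hS : 0 ∉ S) {s : Fin n →₀ ℕ}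
    (hs : ∀ l ≤ s, l ≠ 0 → l ∈ S) (c : (Fin n →₀ ℕ) → ℝ) (r : ℕ) :
    (taylorPoly S c ^ r).coeff s =
      r ! * ∑ L : MultiPartition s, if L.length = r then L.weight c else 0 := by
  classical
  rw [taylorPoly, Finset.sum_pow, MvPolynomial.coeff_sum, ← Finset.sum_filter, Finset.mul_sum]
  simp only [coeff_countPerms_mul_prod_map_monomial]
  rw [← Finset.sum_filter]
  symm
  refine Finset.sum_bij (fun L hL => ⟨L.cols, (Finset.mem_filter.1 hL).2⟩) ?_ ?_ ?_ ?_
  · exact fun L _ => Finset.mem_filter.2 ⟨Finset.mem_sym_iff.2 fun l hl =>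
      hs l (L.le_of_mem_cols hl) (L.ne_zero l hl), L.sum_eq⟩
  · exact fun L _ L' _ h => MultiPartition.ext (congrArg Subtype.val h)
  · intro M hM
    rw [Finset.mem_filter, Finset.mem_sym_iff] at hM
    exact ⟨⟨M.val, fun l hl => ne_of_mem_of_not_mem (hM.1 l hl) hS, hM.2⟩,
      Finset.mem_filter.2 ⟨Finset.mem_univ _, M.2⟩, rfl⟩
  · intro L hL
    obtain rfl : L.length = r := (Finset.mem_filter.1 hL).2
    exact L.factorial_length_mul_weight c

theorem coeff_prod_univ {σ R : Type*} [DecidableEq σ] [CommSemiring R]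
    (Q : Fin d → MvPolynomial σ R) (i : σ →₀ ℕ) :
    (∏ k, Q k).coeff i =
      ∑ s ∈ Finset.piAntidiag (Finset.univ : Finset (Fin d)) i, ∏ k, (Q k).coeff (s k) := by
  rw [← MvPolynomial.coeff_coe, ← MvPolynomial.coeToMvPowerSeries.ringHom_apply, map_prod,
    MvPowerSeries.coeff_prod]
  refine Finset.sum_bij' (fun s _ => ⇑s) (fun s _ => Finsupp.equivFunOnFinite.symm s)
    ?_ ?_ ?_ ?_ ?_
  · intro s hs
    simpa [Finset.mem_finsuppAntidiag, Finset.mem_piAntidiag] using hs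
  · intro s hs
    simpa [Finset.mem_finsuppAntidiag, Finset.mem_piAntidiag] using hs
  · intro s _; ext; simp
  · intro s _; rfl
  · intro s _; simp

theorem le_of_mem_piAntidiag {i : Fin n →₀ ℕ} {s : Fin d → (Fin n →₀ ℕ)}
    (hs : s ∈ Finset.piAntidiag (Finset.univ : Finset (Fin d)) i) (k : Fin d) : s k ≤ i := by
  rw [← (Finset.mem_piAntidiag.1 hs).1]
  exact Finset.single_le_sum (f := s) (fun _ _ => zero_le) (Finset.mem_univ k)

/-- The multi-index `(l(Λ₁), …, l(Λ_d))` of the numbers of columns of a family of partitions: the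
exponent of the monomial that the family contributes to the Bell polynomial. -/
def lengths {s : Fin d → (Fin n →₀ ℕ)} (L : ∀ k, MultiPartition (s k)) : Fin d →₀ ℕ :=
  Finsupp.equivFunOnFinite.symm fun k => (L k).length

theorem degree_lengths_le {i : Fin n →₀ ℕ} {s : Fin d → (Fin n →₀ ℕ)}
    (hs : s ∈ Finset.piAntidiag (Finset.univ : Finset (Fin d)) i)
    (L : ∀ k, MultiPartition (s k)) : (lengths L).degree ≤ i.degree := by
  rw [← (Finset.mem_piAntidiag.1 hs).1, map_sum, Finsupp.degree_eq_sum]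
  exact Finset.sum_le_sum fun k _ => (L k).length_le_degree

theorem constr_bellPolynomial (c : (Fin d →₀ ℕ) → ℝ) (g : Fin d → (Fin n →₀ ℕ) → ℝ)
    (i : Fin n →₀ ℕ) :
    (MvPolynomial.basisMonomials (Fin d) ℝ).constr ℝ c (bellPolynomial g i) =
      multiFactorial i * ∑ s ∈ Finset.piAntidiag (Finset.univ : Finset (Fin d)) i,
        ∑ L : (∀ k, MultiPartition (s k)), c (lengths L) * ∏ k, (L k).weight (g k) := by
  have hmonomial {s : Fin d → (Fin n →₀ ℕ)} (L : ∀ k, MultiPartition (s k)) (a : ℝ) :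
      (∏ k, MvPolynomial.X k ^ (L k).length) * MvPolynomial.C a =
        a • MvPolynomial.basisMonomials (Fin d) ℝ (lengths L) := by
    rw [MvPolynomial.coe_basisMonomials, MvPolynomial.smul_monomial, smul_eq_mul, mul_one,
      MvPolynomial.monomial_eq, Finsupp.prod_fintype _ _ (by simp), mul_comm]
    simp [lengths]
  rw [bellPolynomial, ← MvPolynomial.smul_eq_C_mul, map_smul, smul_eq_mul]
  simp only [hmonomial, map_sum, map_smul, Module.Basis.constr_basis, smul_eq_mul,
    ← Finset.prod_mul_distrib, ← Finset.prod_div_distrib]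
  simp only [mul_comm, MultiPartition.weight]

section Substitution

variable {S : Finset (Fin n →₀ ℕ)} {i : Fin n →₀ ℕ}

theorem coeff_prod_taylorPoly_pow (hS : 0 ∉ S) (hi : ∀ l ≤ i, l ≠ 0 → l ∈ S)
    (g : Fin d → (Fin n →₀ ℕ) → ℝ) (j : Fin d →₀ ℕ) :
    (∏ k, taylorPoly S (g k) ^ j k).coeff i =
      multiFactorial j * ∑ s ∈ Finset.piAntidiag (Finset.univ : Finset (Fin d)) i,
        ∑ L : (∀ k, MultiPartition (s k)),
          if lengths L = j then ∏ k, (L k).weight (g k) else 0 := by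
  classical
  rw [coeff_prod_univ, Finset.mul_sum]
  refine Finset.sum_congr rfl fun s hs => ?_
  have hs' (k) : ∀ l ≤ s k, l ≠ 0 → l ∈ S := fun l hl => hi l (hl.trans (le_of_mem_piAntidiag hs k))
  simp only [coeff_taylorPoly_pow hS (hs' _), Finset.prod_mul_distrib, Fintype.prod_sum]
  rw [multiFactorial, Nat.cast_prod]
  congr! 2 with L
  simp [Finset.prod_ite_zero, lengths, Finsupp.ext_iff]

theorem coeff_bind₁_taylorPoly {J : Finset (Fin d →₀ ℕ)} (hJ : ∀ j, j.degree ≤ i.degree → j ∈ J)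
    (hS : 0 ∉ S) (hi : ∀ l ≤ i, l ≠ 0 → l ∈ S) (c : (Fin d →₀ ℕ) → ℝ)
    (g : Fin d → (Fin n →₀ ℕ) → ℝ) :
    (MvPolynomial.bind₁ (fun k => taylorPoly S (g k)) (taylorPoly J c)).coeff i =
      ∑ s ∈ Finset.piAntidiag (Finset.univ : Finset (Fin d)) i,
        ∑ L : (∀ k, MultiPartition (s k)), c (lengths L) * ∏ k, (L k).weight (g k) := by
  classical
  have hterm (j : Fin d →₀ ℕ) : (MvPolynomial.bind₁ (fun k => taylorPoly S (g k))
      (MvPolynomial.monomial j (c j / multiFactorial j))).coeff i =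
      ∑ s ∈ Finset.piAntidiag (Finset.univ : Finset (Fin d)) i,
        ∑ L : (∀ k, MultiPartition (s k)),
          if lengths L = j then c j * ∏ k, (L k).weight (g k) else 0 := by
    have := multiFactorial_ne_zero j
    rw [MvPolynomial.bind₁_monomial, MvPolynomial.coeff_C_mul,
      ← Finsupp.prod, Finsupp.prod_fintype _ _ (by simp), coeff_prod_taylorPoly_pow hS hi,
      ← mul_assoc, div_mul_cancel₀ _ (by positivity)]
    simp only [Finset.mul_sum, mul_ite, mul_zero]
  rw [taylorPoly, map_sum, MvPolynomial.coeff_sum, Finset.sum_congr rfl fun j _ => hterm j,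
    Finset.sum_comm]
  refine Finset.sum_congr rfl fun s hs => ?_
  rw [Finset.sum_comm]
  simp only [Finset.sum_ite_eq, hJ _ (degree_lengths_le hs _), if_true]

end Substitution

end BellPolynomials

section FaaDiBruno

open scoped ContDiff

variable {n d : ℕ}

theorem mixedPartial_congr {f g : (Fin n → ℝ) → ℝ} {p : Fin n → ℝ} (h : f =ᶠ[𝓝 p] g)
    (i : Fin n →₀ ℕ) : mixedPartial i f p = mixedPartial i g p := by
  rw [mixedPartial_eq_wordDeriv, mixedPartial_eq_wordDeriv]
  generalize (List.finRange n).flatMap _ = w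
  suffices wordDeriv w f =ᶠ[𝓝 p] wordDeriv w g from this.eq_of_nhds
  induction w with
  | nil => exact h
  | cons m w ih => exact partialDeriv_eventuallyEq ih m

theorem mixedPartial_zero (f : (Fin n → ℝ) → ℝ) : mixedPartial 0 f = f := by
  have hnil : ((List.finRange n).flatMap fun _ => []) = ([] : List (Fin n)) :=
    List.flatMap_eq_nil_iff.2 fun _ _ => rfl
  exact (mixedPartial_eq_wordDeriv 0 f).trans (congrArg (wordDeriv · f) hnil)

theorem taylorPoly_eq_C_add_erase {S : Finset (Fin n →₀ ℕ)} (hS : 0 ∈ S)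
    (c : (Fin n →₀ ℕ) → ℝ) :
    taylorPoly S c = MvPolynomial.C (c 0) + taylorPoly (S.erase 0) c := by
  rw [taylorPoly, ← Finset.add_sum_erase _ _ hS, taylorPoly]
  simp [multiFactorial]

theorem eval_bind₁_add_C (P : MvPolynomial (Fin d) ℝ) (Q : Fin d → MvPolynomial (Fin n) ℝ)
    (a : Fin d → ℝ) (z : Fin n → ℝ) :
    MvPolynomial.eval ((fun k => MvPolynomial.eval z (MvPolynomial.C (a k) + Q k)) - a) P =
      MvPolynomial.eval z (MvPolynomial.bind₁ Q P) := by
  have hsub : (fun k => MvPolynomial.eval z (MvPolynomial.C (a k) + Q k)) - a =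
      fun k => MvPolynomial.eval z (Q k) := by
    ext k; simp
  rw [hsub]
  exact (MvPolynomial.eval₂Hom_bind₁ (RingHom.id ℝ) z Q P).symm

/-- It suffices to compare `f` and `g` with their Taylor polynomials, for which composition is
substitution of polynomials. -/
theorem mixedPartial_comp {f : (Fin d → ℝ) → ℝ} {g : (Fin n → ℝ) → (Fin d → ℝ)}
    {p : Fin n → ℝ} (hf : ContDiffAt ℝ ∞ f (g p)) (hg : ContDiffAt ℝ ∞ g p) (i : Fin n →₀ ℕ) :
    mixedPartial i (f ∘ g) p =
      (MvPolynomial.basisMonomials (Fin d) ℝ).constr ℝ (fun j => mixedPartial j f (g p))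
        (bellPolynomial (fun k l => mixedPartial l (fun z => g z k) p) i) := by
  classical
  set c : (Fin d →₀ ℕ) → ℝ := fun j => mixedPartial j f (g p)
  set b : Fin d → (Fin n →₀ ℕ) → ℝ := fun k l => mixedPartial l (fun z => g z k) p
  let J : Finset (Fin d →₀ ℕ) := (Finsupp.finite_of_degree_le i.degree).toFinset
  let S : Finset (Fin n →₀ ℕ) := (Finsupp.finite_of_degree_le i.degree).toFinset
  have hJ (j : Fin d →₀ ℕ) (hj : j.degree ≤ i.degree) : j ∈ J := by simpa [J] using hj
  have hS (l : Fin n →₀ ℕ) (hl : l.degree ≤ i.degree) : l ∈ S := by simpa [S] using hl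
  have hsplit (k) : taylorPoly S (b k) =
      MvPolynomial.C (g p k) + taylorPoly (S.erase 0) (b k) := by
    rw [taylorPoly_eq_C_add_erase (hS 0 (by simp))]
    simp only [b, mixedPartial_zero]
  let f' := fun x => MvPolynomial.eval (x - g p) (taylorPoly J c)
  let g' := fun (z : Fin n → ℝ) k => MvPolynomial.eval (z - p) (taylorPoly S (b k))
  have hg' : ContDiffAt ℝ ∞ g' p := contDiffAt_pi.2 fun k => (contDiff_eval_sub p _).contDiffAt
  have hg'p : g' p = g p := by
    ext k
    have h := mixedPartial_eval_sub_self 0 p (taylorPoly S (b k))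
    rw [multiFactorial_mul_coeff_taylorPoly _ (hS 0 (by simp))] at h
    simpa only [b, mixedPartial_zero] using h
  have hcomp : f' ∘ g' = fun z => MvPolynomial.eval (z - p)
      (MvPolynomial.bind₁ (fun k => taylorPoly (S.erase 0) (b k)) (taylorPoly J c)) := by
    ext z
    simp only [f', g', Function.comp_apply, hsplit, eval_bind₁_add_C]
  rw [mixedPartial_comp_congr hf (contDiff_eval_sub (g p) _).contDiffAt hg hg' rfl hg'p i
    (fun j hj => ?_) (fun k l hl => ?_), hcomp, mixedPartial_eval_sub_self, constr_bellPolynomial,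
    coeff_bind₁_taylorPoly hJ (Finset.notMem_erase 0 _)
      (fun l hl hl0 => Finset.mem_erase.2 ⟨hl0, hS l (Finsupp.degree_mono hl)⟩)]
  · rw [mixedPartial_eval_sub_self, multiFactorial_mul_coeff_taylorPoly c (hJ j hj)]
  · rw [mixedPartial_eval_sub_self, multiFactorial_mul_coeff_taylorPoly _ (hS l hl)]

end FaaDiBruno

section Analyticity

section ExponentialIntegrals

variable {Ω E : Type*} [NormedAddCommGroup E] [NormedSpace ℝ E]

/-- The homogeneous part of degree `N` of the power series of `h ↦ w * exp (L h)` at `0`. -/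
def expTerm (w : ℝ) (L : E →L[ℝ] ℝ) (N : ℕ) : E [×N]→L[ℝ] ℝ :=
  w • (NormedSpace.expSeries ℝ ℝ N).compContinuousLinearMap fun _ => L

theorem expTerm_apply (w : ℝ) (L : E →L[ℝ] ℝ) (N : ℕ) (h : E) :
    expTerm w L N (fun _ => h) = w * (L h ^ N / N !) := by
  rw [expTerm, smul_apply,
    ContinuousMultilinearMap.compContinuousLinearMap_apply, NormedSpace.expSeries_apply_eq,
    smul_eq_mul, smul_eq_mul, inv_mul_eq_div]

theorem norm_expTerm_le (w : ℝ) (L : E →L[ℝ] ℝ) (N : ℕ) :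
    ‖expTerm w L N‖ ≤ |w| * (‖L‖ ^ N / N !) := by
  have hN : ‖NormedSpace.expSeries ℝ ℝ N‖ = (N ! : ℝ)⁻¹ := by
    rw [NormedSpace.expSeries, norm_smul, ContinuousMultilinearMap.norm_mkPiAlgebraFin, mul_one,
      norm_inv, RCLike.norm_natCast]
  calc ‖expTerm w L N‖ ≤ |w| * (‖NormedSpace.expSeries ℝ ℝ N‖ * ∏ _ : Fin N, ‖L‖) := by
        rw [expTerm, norm_smul, Real.norm_eq_abs]
        gcongr
        exact ContinuousMultilinearMap.norm_compContinuousLinearMap_le _ _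
    _ = |w| * (‖L‖ ^ N / N !) := by
        rw [hN, Finset.prod_const, Finset.card_univ, Fintype.card_fin, inv_mul_eq_div]

theorem continuous_expTerm (N : ℕ) :
    Continuous fun x : ℝ × (E →L[ℝ] ℝ) => expTerm x.1 x.2 N := by
  let Φ := ContinuousMultilinearMap.compContinuousLinearMapContinuousMultilinear ℝ
    (fun _ : Fin N => E) (fun _ => ℝ) ℝ
  have hΦ : Continuous fun L : E →L[ℝ] ℝ => Φ fun _ => L :=
    Φ.cont.comp (continuous_pi fun _ => continuous_id)
  exact continuous_fst.smul ((hΦ.comp continuous_snd).clm_apply continuous_const)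

theorem norm_expTerm_mul_pow_le {r : ℝ} (hr : 0 ≤ r) (w : ℝ) (L : E →L[ℝ] ℝ) (N : ℕ) :
    ‖expTerm w L N‖ * r ^ N ≤ |w| * ((r * ‖L‖) ^ N / N !) := by
  calc ‖expTerm w L N‖ * r ^ N ≤ |w| * (‖L‖ ^ N / N !) * r ^ N := by
        gcongr
        exact norm_expTerm_le w L N
    _ = |w| * ((r * ‖L‖) ^ N / N !) := by ring

theorem norm_expTerm_mul_pow_le_exp {r : ℝ} (hr : 0 ≤ r) (w : ℝ) (L : E →L[ℝ] ℝ) (N : ℕ) :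
    ‖expTerm w L N‖ * r ^ N ≤ |w| * Real.exp (r * ‖L‖) :=
  (norm_expTerm_mul_pow_le hr w L N).trans <|
    mul_le_mul_of_nonneg_left (Real.pow_div_factorial_le_exp _ (by positivity) N) (abs_nonneg w)

theorem hasSum_mul_pow_div_factorial (a x : ℝ) :
    HasSum (fun N : ℕ => a * (x ^ N / N !)) (a * Real.exp x) := by
  rw [Real.exp_eq_exp_ℝ]
  exact (NormedSpace.expSeries_div_hasSum_exp x).mul_left a

variable [MeasurableSpace Ω] {P : Measure Ω} {X : Ω → E →L[ℝ] ℝ} {w : Ω → ℝ} {r : ℝ}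

theorem integrable_expTerm (hr : 0 < r) (hX : AEStronglyMeasurable X P)
    (hw : AEStronglyMeasurable w P)
    (hint : Integrable (fun ω => |w ω| * Real.exp (r * ‖X ω‖)) P) (N : ℕ) :
    Integrable (fun ω => expTerm (w ω) (X ω) N) P := by
  refine (hint.div_const (r ^ N)).mono'
    ((continuous_expTerm N).comp_aestronglyMeasurable (hw.prodMk hX)) (.of_forall fun ω => ?_)
  exact (le_div_iff₀ (by positivity)).2 (norm_expTerm_mul_pow_le_exp hr.le _ _ N)

theorem hasFPowerSeriesOnBall_integral_exp (hr : 0 < r) (hX : AEStronglyMeasurable X P)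
    (hw : AEStronglyMeasurable w P)
    (hint : Integrable (fun ω => |w ω| * Real.exp (r * ‖X ω‖)) P) :
    HasFPowerSeriesOnBall (fun h => ∫ ω, w ω * Real.exp (X ω h) ∂P)
      (fun N => ∫ ω, expTerm (w ω) (X ω) N ∂P) 0 (ENNReal.ofReal r) where
  r_le := by
    refine FormalMultilinearSeries.le_radius_of_bound _
      (∫ ω, |w ω| * Real.exp (r * ‖X ω‖) ∂P) fun N => ?_
    rw [Real.coe_toNNReal r hr.le]
    calc ‖∫ ω, expTerm (w ω) (X ω) N ∂P‖ * r ^ N ≤ (∫ ω, ‖expTerm (w ω) (X ω) N‖ ∂P) * r ^ N := by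
          gcongr
          exact norm_integral_le_integral_norm _
      _ = ∫ ω, ‖expTerm (w ω) (X ω) N‖ * r ^ N ∂P := (integral_mul_const _ _).symm
      _ ≤ ∫ ω, |w ω| * Real.exp (r * ‖X ω‖) ∂P :=
          integral_mono ((integrable_expTerm hr hX hw hint N).norm.mul_const _) hint
            fun ω => norm_expTerm_mul_pow_le_exp hr.le _ _ N
  r_pos := ENNReal.ofReal_pos.2 hr
  hasSum {h} hh := by
    have hh' : ‖h‖ ≤ r := by
      rw [Metric.mem_eball, edist_zero_right, ← ofReal_norm, ENNReal.ofReal_lt_ofReal_iff hr] at hh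
      exact hh.le
    simp only [zero_add,
      ContinuousMultilinearMap.integral_apply (integrable_expTerm hr hX hw hint _)]
    refine hasSum_integral_of_dominated_convergence
      (fun N ω => |w ω| * ((r * ‖X ω‖) ^ N / N !))
      (fun N => (continuous_eval_const fun _ => h).comp_aestronglyMeasurable
        (integrable_expTerm hr hX hw hint N).1)
      (fun N => .of_forall fun ω => ?_)
      (.of_forall fun ω => (hasSum_mul_pow_div_factorial _ _).summable)
      ?_ (.of_forall fun ω => ?_)
    · calc ‖expTerm (w ω) (X ω) N fun _ => h‖ ≤ ‖expTerm (w ω) (X ω) N‖ * ∏ _ : Fin N, ‖h‖ :=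
            ContinuousMultilinearMap.le_opNorm _ _
        _ ≤ ‖expTerm (w ω) (X ω) N‖ * r ^ N := by
            rw [Finset.prod_const, Finset.card_univ, Fintype.card_fin]
            gcongr
        _ ≤ |w ω| * ((r * ‖X ω‖) ^ N / N !) := norm_expTerm_mul_pow_le hr.le _ _ N
    · simpa only [(hasSum_mul_pow_div_factorial _ _).tsum_eq] using hint
    · simpa only [expTerm_apply] using hasSum_mul_pow_div_factorial (w ω) (X ω h)

end ExponentialIntegrals

section CumulantGeneratingFunction

variable {Ω : Type*} [MeasurableSpace Ω] {P : Measure Ω} {n : ℕ} {X : Ω → (Fin n → ℝ)}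
  {z : Fin n → ℝ}

theorem exp_mul_abs_le (r x : ℝ) :
    Real.exp (r * |x|) ≤ Real.exp (r * x) + Real.exp (-r * x) := by
  rcases abs_choice x with h | h <;> rw [h]
  · exact le_add_of_nonneg_right (Real.exp_pos _).le
  · rw [mul_neg, ← neg_mul]
    exact le_add_of_nonneg_left (Real.exp_pos _).le

theorem exp_mul_sum_abs_le {r : ℝ} (hr : 0 < r) (x : Fin n → ℝ) :
    Real.exp (r * ∑ m, |x m|) ≤
      ∑ h ∈ Fintype.piFinset fun _ : Fin n => ({r, -r} : Finset ℝ), Real.exp (∑ m, h m * x m) := by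
  calc Real.exp (r * ∑ m, |x m|) = ∏ m, Real.exp (r * |x m|) := by
        rw [Finset.mul_sum, Real.exp_sum]
    _ ≤ ∏ m, ∑ ε ∈ ({r, -r} : Finset ℝ), Real.exp (ε * x m) :=
        Finset.prod_le_prod (fun _ _ => (Real.exp_pos _).le) fun m _ => by
          rw [Finset.sum_pair (by linarith)]
          exact exp_mul_abs_le r (x m)
    _ = _ := by simp only [Finset.prod_univ_sum, Real.exp_sum]

theorem exists_integrable_exp_mul_exp_sum_abs (hX : Measurable X)
    (hz : ∀ᶠ w in 𝓝 z, FiniteMGFAt X P w) :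
    ∃ r > 0, Integrable
      (fun ω => Real.exp (∑ m, z m * X ω m) * Real.exp (r * ∑ m, |X ω m|)) P := by
  obtain ⟨r, hr, hball⟩ := Metric.nhds_basis_closedBall.eventually_iff.1 hz
  refine ⟨r, hr, ?_⟩
  have hsum : Integrable (fun ω => ∑ h ∈ Fintype.piFinset fun _ : Fin n => ({r, -r} : Finset ℝ),
      Real.exp (∑ m, (z + h) m * X ω m)) P := by
    refine integrable_finsetSum _ fun h hh => hball ?_
    rw [Metric.mem_closedBall, dist_eq_norm, add_sub_cancel_left, pi_norm_le_iff_of_nonneg hr.le]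
    intro m
    have hm := Fintype.mem_piFinset.1 hh m
    rcases Finset.mem_insert.1 hm with hm | hm
    · simp [hm, abs_of_pos hr]
    · simp [Finset.mem_singleton.1 hm, abs_of_pos hr]
  refine hsum.mono' (by fun_prop) (.of_forall fun ω => ?_)
  rw [Real.norm_of_nonneg (by positivity)]
  calc _ ≤ Real.exp (∑ m, z m * X ω m) * ∑ h ∈ Fintype.piFinset fun _ : Fin n =>
        ({r, -r} : Finset ℝ), Real.exp (∑ m, h m * X ω m) := by
        gcongr
        exact exp_mul_sum_abs_le hr _
    _ = _ := by
        simp only [Finset.mul_sum, ← Real.exp_add, ← Finset.sum_add_distrib, ← add_mul,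
          Pi.add_apply]

theorem norm_sum_smul_proj_le (x : Fin n → ℝ) :
    ‖(∑ m, x m • ContinuousLinearMap.proj m : (Fin n → ℝ) →L[ℝ] ℝ)‖ ≤ ∑ m, |x m| := by
  refine ContinuousLinearMap.opNorm_le_bound _ (by positivity) fun h => ?_
  simp only [sum_apply, smul_apply, ContinuousLinearMap.proj_apply, smul_eq_mul, Finset.sum_mul]
  refine norm_sum_le_of_le _ fun m _ => ?_
  rw [norm_mul, Real.norm_eq_abs (x m)]
  gcongr
  exact norm_le_pi_norm h m

theorem analyticAt_integral_exp (hX : Measurable X) (hz : ∀ᶠ w in 𝓝 z, FiniteMGFAt X P w) :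
    AnalyticAt ℝ (fun w => ∫ ω, Real.exp (∑ m, w m * X ω m) ∂P) z := by
  obtain ⟨r, hr, hint⟩ := exists_integrable_exp_mul_exp_sum_abs hX hz
  let L (x : Fin n → ℝ) : (Fin n → ℝ) →L[ℝ] ℝ := ∑ m, x m • ContinuousLinearMap.proj m
  have hLmeas : AEStronglyMeasurable (fun ω => L (X ω)) P :=
    (show Continuous L by fun_prop).comp_aestronglyMeasurable hX.aestronglyMeasurable
  have hint' : Integrable
      (fun ω => |Real.exp (∑ m, z m * X ω m)| * Real.exp (r * ‖L (X ω)‖)) P := by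
    refine hint.mono' (.mul (by fun_prop) (Real.continuous_exp.comp_aestronglyMeasurable
      (hLmeas.norm.const_mul r))) (.of_forall fun ω => ?_)
    rw [Real.norm_of_nonneg (by positivity), abs_of_pos (Real.exp_pos _)]
    gcongr
    exact norm_sum_smul_proj_le _
  have hseries := hasFPowerSeriesOnBall_integral_exp hr hLmeas (by fun_prop) hint'
  have hanalytic := hseries.analyticAt.comp_sub z
  rw [zero_add] at hanalytic
  refine hanalytic.congr (.of_eq (funext fun w => integral_congr_ae (.of_forall fun ω => ?_)))
  simp only [L, ← Real.exp_add, sum_apply, smul_apply, ContinuousLinearMap.proj_apply,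
    smul_eq_mul, ← Finset.sum_add_distrib, Pi.sub_apply]
  congr! 2
  ring

theorem analyticAt_jointCgf [NeZero P] (hX : Measurable X)
    (hz : ∀ᶠ w in 𝓝 z, FiniteMGFAt X P w) : AnalyticAt ℝ (jointCgf X P) z := by
  have hpos : 0 < ∫ ω, Real.exp (∑ m, z m * X ω m) ∂P := integral_exp_pos hz.self_of_nhds
  exact (analyticAt_log hpos).comp_of_eq (analyticAt_integral_exp hX hz) rfl

end CumulantGeneratingFunction

end Analyticity

section RightApproximation

open scoped ENNReal

/-- The point `(⌊(N + 1) t⌋ + 1) / (N + 1)`: the first point of the grid of mesh `1 / (N + 1)` to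
the right of `t`. -/
def gridPoint (N : ℕ) (t : ℝ≥0) : ℝ≥0 := (⌊(N + 1) * t⌋₊ + 1) / (N + 1)

theorem tendsto_gridPoint (t : ℝ≥0) : Tendsto (fun N => gridPoint N t) atTop (𝓝[≥] t) := by
  have hle (N : ℕ) : t ≤ gridPoint N t := by
    rw [gridPoint, le_div_iff₀ (by positivity), mul_comm]
    exact (Nat.lt_floor_add_one _).le
  have hge (N : ℕ) : gridPoint N t ≤ t + 1 / ((N : ℝ≥0) + 1) := by
    have hN : (N : ℝ≥0) + 1 ≠ 0 := by positivity
    rw [gridPoint, div_le_iff₀ (by positivity), add_mul t, one_div, inv_mul_cancel₀ hN, mul_comm t]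
    gcongr
    exact Nat.floor_le zero_le
  refine tendsto_nhdsWithin_iff.2 ⟨?_, .of_forall hle⟩
  refine tendsto_of_tendsto_of_tendsto_of_le_of_le tendsto_const_nhds ?_ hle hge
  simpa using (tendsto_const_nhds (x := t)).add
    (tendsto_one_div_add_atTop_nhds_zero_nat (𝕜 := ℝ≥0))

/-- The value at `t` of the right-continuous path `x`. Unlike evaluation at a random time,
`rightEval` is jointly measurable in `x` and `t` for the product `σ`-algebra on paths. -/
def rightEval (x : ℝ≥0 → ℝ) (t : ℝ≥0) : ℝ := limsup (fun N => x (gridPoint N t)) atTop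

theorem rightEval_eq {x : ℝ≥0 → ℝ} {t : ℝ≥0} (hx : ContinuousWithinAt x (Set.Ici t) t) :
    rightEval x t = x t :=
  (hx.tendsto.comp (tendsto_gridPoint t)).limsup_eq

theorem measurable_apply_gridPoint (N : ℕ) :
    Measurable fun y : (ℝ≥0 → ℝ) × ℝ≥0 => y.1 (gridPoint N y.2) := by
  have hfloor : Measurable fun y : (ℝ≥0 → ℝ) × ℝ≥0 => (y.1, ⌊((N : ℝ≥0) + 1) * y.2⌋₊) :=
    measurable_fst.prodMk (Nat.measurable_floor.comp (by fun_prop))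
  have happly : Measurable fun y : (ℝ≥0 → ℝ) × ℕ => y.1 ((y.2 + 1) / (N + 1)) :=
    measurable_from_prod_countable_left fun j => measurable_pi_apply (((j : ℝ≥0) + 1) / (N + 1))
  exact happly.comp hfloor

theorem measurable_rightEval {α : Type*} [MeasurableSpace α] {x : α → ℝ≥0 → ℝ} {t : α → ℝ≥0}
    (hx : Measurable x) (ht : Measurable t) : Measurable fun a => rightEval (x a) (t a) :=
  .limsup fun N => (measurable_apply_gridPoint N).comp (hx.prodMk ht)

variable {f : ℝ≥0 → ℝ≥0∞} {κ : ℝ}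

theorem apply_natCast_mul (hadd : ∀ s t, f (s + t) = f s * f t) (h0 : f 0 = 1)
    (j : ℕ) (t : ℝ≥0) : f (j * t) = f t ^ j := by
  induction j with
  | zero => simp [h0]
  | succ j ih => rw [Nat.cast_succ, add_mul, one_mul, hadd, ih, pow_succ]

theorem apply_natCast_div_natCast (hadd : ∀ s t, f (s + t) = f s * f t) (h0 : f 0 = 1)
    (h1 : f 1 = .ofReal (Real.exp κ)) (j : ℕ) {N : ℕ} (hN : N ≠ 0) :
    f (j / N) = .ofReal (Real.exp ((j / N : ℝ≥0) * κ)) := by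
  have hroot : f (N : ℝ≥0)⁻¹ = .ofReal (Real.exp ((N : ℝ)⁻¹ * κ)) := by
    refine (ENNReal.pow_right_strictMono hN).injective ?_
    rw [← apply_natCast_mul hadd h0, mul_inv_cancel₀ (Nat.cast_ne_zero.2 hN), h1,
      ← ENNReal.ofReal_pow (Real.exp_pos _).le, ← Real.exp_nat_mul,
      mul_inv_cancel_left₀ (Nat.cast_ne_zero.2 hN)]
  rw [div_eq_mul_inv, apply_natCast_mul hadd h0, hroot, ← ENNReal.ofReal_pow (Real.exp_pos _).le,
    ← Real.exp_nat_mul, ← mul_assoc]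
  push_cast
  rfl

theorem apply_le_exp_mul (hadd : ∀ s t, f (s + t) = f s * f t) (h0 : f 0 = 1)
    (h1 : f 1 = .ofReal (Real.exp κ))
    (hlsc : ∀ (t : ℝ≥0) (s : ℕ → ℝ≥0), Tendsto s atTop (𝓝[≥] t) →
      f t ≤ liminf (fun N => f (s N)) atTop) (t : ℝ≥0) :
    f t ≤ .ofReal (Real.exp (t * κ)) := by
  have hgrid (N : ℕ) : f (gridPoint N t) = .ofReal (Real.exp (gridPoint N t * κ)) := by
    simpa [gridPoint] using
      apply_natCast_div_natCast hadd h0 h1 (⌊(N + 1) * t⌋₊ + 1) N.succ_ne_zero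
  have hlim : Tendsto (fun N => f (gridPoint N t)) atTop (𝓝 (.ofReal (Real.exp (t * κ)))) := by
    simp only [hgrid]
    have hcont : Continuous fun s : ℝ≥0 => ENNReal.ofReal (Real.exp (s * κ)) :=
      ENNReal.continuous_ofReal.comp (by fun_prop)
    exact (hcont.tendsto t).comp ((tendsto_gridPoint t).mono_right nhdsWithin_le_nhds)
  exact (hlsc t _ (tendsto_gridPoint t)).trans_eq hlim.liminf_eq

/-- Solutions of Cauchy's exponential equation are determined on the rationals. Lower semicontinuity
bounds `f t` from above and, applied to `f (j - t)` for an integer `j ≥ t`, from below. -/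
theorem eq_exp_mul_of_add_eq_mul (hadd : ∀ s t, f (s + t) = f s * f t) (h0 : f 0 = 1)
    (h1 : f 1 = .ofReal (Real.exp κ))
    (hlsc : ∀ (t : ℝ≥0) (s : ℕ → ℝ≥0), Tendsto s atTop (𝓝[≥] t) →
      f t ≤ liminf (fun N => f (s N)) atTop) (t : ℝ≥0) :
    f t = .ofReal (Real.exp (t * κ)) := by
  have hle := apply_le_exp_mul hadd h0 h1 hlsc
  refine le_antisymm (hle t) ?_
  obtain ⟨j, hj⟩ := exists_nat_ge t
  have hsplit : t + (j - t) = j := add_tsub_cancel_of_le hj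
  have hprod : ENNReal.ofReal (Real.exp (t * κ)) * .ofReal (Real.exp ((j - t : ℝ≥0) * κ)) =
      f t * f (j - t) := by
    rw [← hadd, hsplit, ← ENNReal.ofReal_mul (Real.exp_pos _).le, ← Real.exp_add, ← add_mul,
      ← NNReal.coe_add, hsplit]
    simpa using (apply_natCast_div_natCast hadd h0 h1 j one_ne_zero).symm
  refine (ENNReal.mul_le_mul_iff_left (by simp [Real.exp_pos]) ENNReal.ofReal_ne_top).1
    (hprod.trans_le (mul_le_mul_right (hle (j - t)) (f t)))

end RightApproximation

section LevyProcess

open scoped ENNReal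

variable {Ω : Type*} [MeasurableSpace Ω] {P : Measure Ω}

/-- The moment generating function of `X t` at `u` as an integral with values in `[0, ∞]`, which is
meaningful before integrability is known. -/
def lexpMoment (X : ℝ≥0 → Ω → ℝ) (P : Measure Ω) (u : ℝ) (t : ℝ≥0) : ℝ≥0∞ :=
  ∫⁻ ω, .ofReal (Real.exp (u * X t ω)) ∂P

namespace IsLevyProcess

variable {X : ℝ≥0 → Ω → ℝ}

theorem lexpMoment_zero [IsProbabilityMeasure P] (hX : IsLevyProcess X P) (u : ℝ) :
    lexpMoment X P u 0 = 1 := by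
  have hone : ∀ᵐ ω ∂P, ENNReal.ofReal (Real.exp (u * X 0 ω)) = 1 := by
    filter_upwards [hX.start_zero] with ω hω
    simp [hω]
  simp [lexpMoment, lintegral_congr_ae hone]

theorem lexpMoment_add (hX : IsLevyProcess X P) (u : ℝ) (s t : ℝ≥0) :
    lexpMoment X P u (s + t) = lexpMoment X P u s * lexpMoment X P u t := by
  let e : ℝ → ℝ≥0∞ := fun x => .ofReal (Real.exp (u * x))
  have he : Measurable e := by fun_prop
  have hind : IndepFun (X s) (X (s + t) - X s) P :=
    hX.indep_increments.indepFun_eval_sub zero_le le_self_add hX.start_zero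
  have hincr : ∫⁻ ω, e ((X (s + t) - X s) ω) ∂P = ∫⁻ ω, e (X t ω) ∂P := by
    refine ((hX.stationary_increments s t).comp he).lintegral_eq.trans (lintegral_congr_ae ?_)
    filter_upwards [hX.start_zero] with ω hω
    simp [hω]
  calc lexpMoment X P u (s + t) = ∫⁻ ω, e (X s ω) * e ((X (s + t) - X s) ω) ∂P := by
        refine lintegral_congr fun ω => ?_
        rw [← ENNReal.ofReal_mul (Real.exp_pos _).le, ← Real.exp_add, ← mul_add, Pi.sub_apply,
          add_sub_cancel]
    _ = (∫⁻ ω, e (X s ω) ∂P) * ∫⁻ ω, e ((X (s + t) - X s) ω) ∂P :=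
        lintegral_mul_eq_lintegral_mul_lintegral_of_indepFun (he.comp (hX.measurable s))
          (he.comp ((hX.measurable (s + t)).sub (hX.measurable s))) (hind.comp he he)
    _ = lexpMoment X P u s * lexpMoment X P u t := by rw [hincr]; rfl

theorem lexpMoment_le_liminf (hX : IsLevyProcess X P) (u : ℝ) {t : ℝ≥0} {s : ℕ → ℝ≥0}
    (hs : Tendsto s atTop (𝓝[≥] t)) :
    lexpMoment X P u t ≤ liminf (fun N => lexpMoment X P u (s N)) atTop := by
  let e : ℝ → ℝ≥0∞ := fun x => .ofReal (Real.exp (u * x))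
  have he : Continuous e := ENNReal.continuous_ofReal.comp (by fun_prop)
  calc ∫⁻ ω, e (X t ω) ∂P = ∫⁻ ω, liminf (fun N => e (X (s N) ω)) atTop ∂P := by
        refine lintegral_congr_ae (hX.cadlag.mono fun ω hω => ?_)
        exact ((he.tendsto _).comp ((hω t).1.tendsto.comp hs)).liminf_eq.symm
    _ ≤ liminf (fun N => ∫⁻ ω, e (X (s N) ω) ∂P) atTop :=
        lintegral_liminf_le fun N => he.measurable.comp (hX.measurable _)

theorem lexpMoment_eq [IsProbabilityMeasure P] (hX : IsLevyProcess X P) {u : ℝ}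
    (hu : Integrable (fun ω => Real.exp (u * X 1 ω)) P) (t : ℝ≥0) :
    lexpMoment X P u t = .ofReal (Real.exp (t * cgf (X 1) P u)) := by
  have hone : lexpMoment X P u 1 = .ofReal (Real.exp (cgf (X 1) P u)) := by
    rw [exp_cgf hu, mgf, ofReal_integral_eq_lintegral_ofReal hu
      (.of_forall fun _ => (Real.exp_pos _).le)]
    rfl
  exact eq_exp_mul_of_add_eq_mul (hX.lexpMoment_add u) (hX.lexpMoment_zero u) hone
    (fun _ _ => hX.lexpMoment_le_liminf u) t

end IsLevyProcess

end LevyProcess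

section Subordination

open scoped ENNReal

variable {Ω : Type*} [MeasurableSpace Ω] {P : Measure Ω} {n d : ℕ}

theorem integrable_and_integral_eq_of_lintegral_eq {f g : Ω → ℝ} (hf : AEMeasurable f P)
    (hf0 : 0 ≤ᵐ[P] f) (hg : Integrable g P) (hg0 : 0 ≤ᵐ[P] g)
    (h : ∫⁻ ω, .ofReal (f ω) ∂P = ∫⁻ ω, .ofReal (g ω) ∂P) :
    Integrable f P ∧ ∫ ω, f ω ∂P = ∫ ω, g ω ∂P := by
  constructor
  · rw [← lintegral_ofReal_ne_top_iff_integrable hf.aestronglyMeasurable hf0, h]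
    exact (lintegral_ofReal_ne_top_iff_integrable hg.aestronglyMeasurable hg0).2 hg
  · rw [integral_eq_lintegral_of_nonneg_ae hf0 hf.aestronglyMeasurable, h,
      ← integral_eq_lintegral_of_nonneg_ae hg0 hg.aestronglyMeasurable]

theorem lintegral_comp_prodMk_of_indepFun [IsFiniteMeasure P] {E F : Type*} [MeasurableSpace E]
    [MeasurableSpace F] {X : Ω → E} {Y : Ω → F} (hX : Measurable X) (hY : Measurable Y)
    (hXY : IndepFun X Y P) {f : E × F → ℝ≥0∞} (hf : Measurable f) :
    ∫⁻ ω, f (X ω, Y ω) ∂P = ∫⁻ ω, ∫⁻ ω', f (X ω', Y ω) ∂P ∂P := by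
  calc ∫⁻ ω, f (X ω, Y ω) ∂P = ∫⁻ y, f y ∂(P.map fun ω => (X ω, Y ω)) :=
        (lintegral_map hf (hX.prodMk hY)).symm
    _ = ∫⁻ y, ∫⁻ x, f (x, y) ∂(P.map X) ∂(P.map Y) := by
        rw [(indepFun_iff_map_prod_eq_prod_map_map hX.aemeasurable hY.aemeasurable).1 hXY,
          lintegral_prod_symm' _ hf]
    _ = ∫⁻ ω, ∫⁻ x, f (x, Y ω) ∂(P.map X) ∂P := lintegral_map hf.lintegral_prod_left' hY
    _ = ∫⁻ ω, ∫⁻ ω', f (X ω', Y ω) ∂P ∂P :=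
        lintegral_congr fun ω => lintegral_map (hf.comp measurable_prodMk_right) hX

theorem ofReal_exp_sum {ι : Type*} (s : Finset ι) (f : ι → ℝ) :
    ENNReal.ofReal (Real.exp (∑ k ∈ s, f k)) = ∏ k ∈ s, .ofReal (Real.exp (f k)) := by
  rw [Real.exp_sum, ENNReal.ofReal_prod_of_nonneg fun _ _ => (Real.exp_pos _).le]

namespace IsLevyProcess

variable {X : ℝ≥0 → Ω → ℝ}

theorem measurable_path (hX : IsLevyProcess X P) : Measurable fun ω t => X t ω :=
  measurable_pi_lambda _ hX.measurable

theorem ae_rightEval_eq (hX : IsLevyProcess X P) :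
    ∀ᵐ ω ∂P, ∀ t, rightEval (fun s => X s ω) t = X t ω :=
  hX.cadlag.mono fun _ hω t => rightEval_eq (hω t).1

theorem aemeasurable_apply (hX : IsLevyProcess X P) {τ : Ω → ℝ≥0} (hτ : Measurable τ) :
    AEMeasurable (fun ω => X (τ ω) ω) P :=
  (measurable_rightEval hX.measurable_path hτ).aemeasurable.congr
    (hX.ae_rightEval_eq.mono fun ω hω => hω (τ ω))

end IsLevyProcess

theorem IsSubordinator.ae_nonneg {T : ℝ≥0 → Ω → (Fin d → ℝ)} (hT : IsSubordinator T P)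
    (t : ℝ≥0) : ∀ᵐ ω ∂P, ∀ k, 0 ≤ T t ω k := by
  filter_upwards [hT.isLevy.start_zero, hT.increasing] with ω hzero hmono k
  simpa only [hzero, Pi.zero_apply] using hmono k (zero_le (a := t))

section TimeChange

variable [IsProbabilityMeasure P] {Z : Fin d → ℝ≥0 → Ω → ℝ}

theorem lintegral_exp_sum_mul_apply (hZ : ∀ k, IsLevyProcess (Z k) P)
    (hind : iIndepFun (fun k ω t => Z k t ω) P) {u : Fin d → ℝ}
    (hu : ∀ k, Integrable (fun ω => Real.exp (u k * Z k 1 ω)) P) (t : Fin d → ℝ≥0) :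
    ∫⁻ ω, .ofReal (Real.exp (∑ k, u k * Z k (t k) ω)) ∂P =
      .ofReal (Real.exp (∑ k, t k * cgf (Z k 1) P (u k))) := by
  have hexp (k : Fin d) :
      Measurable fun x : ℝ≥0 → ℝ => ENNReal.ofReal (Real.exp (u k * x (t k))) := by fun_prop
  calc ∫⁻ ω, .ofReal (Real.exp (∑ k, u k * Z k (t k) ω)) ∂P
      = ∫⁻ ω, ∏ k, .ofReal (Real.exp (u k * Z k (t k) ω)) ∂P := by simp only [ofReal_exp_sum]
    _ = ∏ k, lexpMoment (Z k) P (u k) (t k) :=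
        lintegral_prod_eq_prod_lintegral_of_indepFun Finset.univ _ (hind.comp _ hexp)
          fun k => (hexp k).comp (hZ k).measurable_path
    _ = .ofReal (Real.exp (∑ k, t k * cgf (Z k 1) P (u k))) := by
        simp only [ofReal_exp_sum, (hZ _).lexpMoment_eq (hu _)]

theorem lintegral_exp_sum_mul_apply_random (hZ : ∀ k, IsLevyProcess (Z k) P)
    (hind : iIndepFun (fun k ω t => Z k t ω) P) {τ : Ω → Fin d → ℝ≥0} (hτ : Measurable τ)
    (hZτ : IndepFun (fun ω k t => Z k t ω) τ P) {u : Fin d → ℝ}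
    (hu : ∀ k, Integrable (fun ω => Real.exp (u k * Z k 1 ω)) P) :
    ∫⁻ ω, .ofReal (Real.exp (∑ k, u k * Z k (τ ω k) ω)) ∂P =
      ∫⁻ ω, .ofReal (Real.exp (∑ k, τ ω k * cgf (Z k 1) P (u k))) ∂P := by
  let f : (Fin d → ℝ≥0 → ℝ) × (Fin d → ℝ≥0) → ℝ≥0∞ := fun y =>
    .ofReal (Real.exp (∑ k, u k * rightEval (y.1 k) (y.2 k)))
  have hf : Measurable f := by
    have heval (k : Fin d) : Measurable fun y : (Fin d → ℝ≥0 → ℝ) × (Fin d → ℝ≥0) =>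
        rightEval (y.1 k) (y.2 k) := measurable_rightEval (by fun_prop) (by fun_prop)
    fun_prop
  have hfZ : ∀ᵐ ω ∂P, ∀ t : Fin d → ℝ≥0, f (fun k s => Z k s ω, t) =
      .ofReal (Real.exp (∑ k, u k * Z k (t k) ω)) := by
    filter_upwards [ae_all_iff.2 fun k => (hZ k).ae_rightEval_eq] with ω hω t
    simp only [f, hω]
  have hZmeas : Measurable fun ω k t => Z k t ω :=
    measurable_pi_lambda _ fun k => (hZ k).measurable_path
  calc ∫⁻ ω, .ofReal (Real.exp (∑ k, u k * Z k (τ ω k) ω)) ∂P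
      = ∫⁻ ω, f (fun k t => Z k t ω, τ ω) ∂P :=
        lintegral_congr_ae (hfZ.mono fun ω hω => (hω (τ ω)).symm)
    _ = ∫⁻ ω, ∫⁻ ω', f (fun k t => Z k t ω', τ ω) ∂P ∂P :=
        lintegral_comp_prodMk_of_indepFun hZmeas hτ hZτ hf
    _ = ∫⁻ ω, .ofReal (Real.exp (∑ k, τ ω k * cgf (Z k 1) P (u k))) ∂P := by
        refine lintegral_congr fun ω => ?_
        rw [lintegral_congr_ae (hfZ.mono fun ω' hω' => hω' (τ ω)),
          lintegral_exp_sum_mul_apply hZ hind hu]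

/-- The random vector `(Z₁(τ₁), …, Z_d(τ_d))`. As in `subordinated`, the times are real-valued and
negative ones are read as `0`. -/
def timeChange (Z : Fin d → ℝ≥0 → Ω → ℝ) (τ : Ω → Fin d → ℝ) : Ω → Fin d → ℝ :=
  fun ω k => Z k (τ ω k).toNNReal ω

theorem finiteMGFAt_timeChange_and_jointCgf_eq (hZ : ∀ k, IsLevyProcess (Z k) P)
    (hind : iIndepFun (fun k ω t => Z k t ω) P) {τ : Ω → Fin d → ℝ} (hτ : Measurable τ)
    (hτ0 : ∀ᵐ ω ∂P, ∀ k, 0 ≤ τ ω k) (hZτ : IndepFun (fun ω k t => Z k t ω) τ P) {u : Fin d → ℝ}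
    (hu : ∀ k, Integrable (fun ω => Real.exp (u k * Z k 1 ω)) P)
    (hfin : FiniteMGFAt τ P fun k => cgf (Z k 1) P (u k)) :
    FiniteMGFAt (timeChange Z τ) P u ∧
      jointCgf (timeChange Z τ) P u = jointCgf τ P fun k => cgf (Z k 1) P (u k) := by
  let σ : Ω → Fin d → ℝ≥0 := fun ω k => (τ ω k).toNNReal
  have htoNNReal : Measurable fun (x : Fin d → ℝ) k => (x k).toNNReal := by fun_prop
  have hσ : Measurable σ := htoNNReal.comp hτ
  have happly (k : Fin d) : AEMeasurable (fun ω => Z k (σ ω k) ω) P :=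
    (hZ k).aemeasurable_apply (by fun_prop)
  have hmeas : AEMeasurable (fun ω => Real.exp (∑ k, u k * Z k (σ ω k) ω)) P :=
    Real.measurable_exp.comp_aemeasurable
      (Finset.aemeasurable_fun_sum _ fun k _ => (happly k).const_mul (u k))
  have hcond : ∫⁻ ω, .ofReal (Real.exp (∑ k, u k * Z k (σ ω k) ω)) ∂P =
      ∫⁻ ω, .ofReal (Real.exp (∑ k, cgf (Z k 1) P (u k) * τ ω k)) ∂P := by
    rw [lintegral_exp_sum_mul_apply_random hZ hind hσ (hZτ.comp measurable_id htoNNReal) hu]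
    refine lintegral_congr_ae (hτ0.mono fun ω hω => ?_)
    simp only [σ, Real.coe_toNNReal _ (hω _), mul_comm]
  obtain ⟨hint, heq⟩ := integrable_and_integral_eq_of_lintegral_eq hmeas
    (.of_forall fun _ => (Real.exp_pos _).le) hfin (.of_forall fun _ => (Real.exp_pos _).le) hcond
  exact ⟨hint, congrArg Real.log heq⟩

end TimeChange

section LinearImage

variable (A : Matrix (Fin n) (Fin d) ℝ)

theorem sum_mul_mulVec (z : Fin n → ℝ) (x : Fin d → ℝ) :
    ∑ m, z m * A.mulVec x m = ∑ k, (∑ m, A m k * z m) * x k := by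
  simpa only [dotProduct, Matrix.vecMul, mul_comm] using Matrix.dotProduct_mulVec z A x

theorem finiteMGFAt_mulVec {X : Ω → Fin d → ℝ} {z : Fin n → ℝ} :
    FiniteMGFAt (fun ω => A.mulVec (X ω)) P z ↔ FiniteMGFAt X P fun k => ∑ m, A m k * z m := by
  simp only [FiniteMGFAt, sum_mul_mulVec]

theorem jointCgf_mulVec (X : Ω → Fin d → ℝ) (z : Fin n → ℝ) :
    jointCgf (fun ω => A.mulVec (X ω)) P z = jointCgf X P fun k => ∑ m, A m k * z m := by
  simp only [jointCgf, sum_mul_mulVec]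

/-- The map `z ↦ (K_{X₁}(⟨a₁, z⟩), …, K_{X_d}(⟨a_d, z⟩))`, where `a₁, …, a_d` are the columns of
`A`: the inner function in the formula for `K_Y`. -/
def columnCgf (X : Fin d → Ω → ℝ) (P : Measure Ω) (z : Fin n → ℝ) : Fin d → ℝ :=
  fun k => cgf (X k) P (∑ m, A m k * z m)

theorem columnCgf_zero [IsProbabilityMeasure P] (X : Fin d → Ω → ℝ) :
    columnCgf A X P 0 = 0 := by
  ext k
  simp [columnCgf]

variable {X : Fin d → Ω → ℝ}

theorem contDiffAt_cgf_zero {Y : Ω → ℝ}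
    (hY : ∀ᶠ u in 𝓝 (0 : ℝ), Integrable (fun ω => Real.exp (u * Y ω)) P) :
    ContDiffAt ℝ (⊤ : ℕ∞) (cgf Y P) 0 :=
  (analyticAt_cgf (mem_interior_iff_mem_nhds.2 hY)).contDiffAt

theorem contDiffAt_columnCgf_zero
    (hX : ∀ k, ∀ᶠ u in 𝓝 (0 : ℝ), Integrable (fun ω => Real.exp (u * X k ω)) P) :
    ContDiffAt ℝ (⊤ : ℕ∞) (columnCgf A X P) 0 := by
  refine contDiffAt_pi.2 fun k => ?_
  have hlin : ContDiffAt ℝ (⊤ : ℕ∞) (fun z : Fin n → ℝ => ∑ m, A m k * z m) 0 := by fun_prop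
  have hcgf : ContDiffAt ℝ (⊤ : ℕ∞) (cgf (X k) P) (∑ m, A m k * (0 : Fin n → ℝ) m) := by
    simpa using contDiffAt_cgf_zero (hX k)
  exact hcgf.comp (f := fun z : Fin n → ℝ => ∑ m, A m k * z m) 0 hlin

theorem mixedPartial_columnCgf_zero
    (hX : ∀ k, ∀ᶠ u in 𝓝 (0 : ℝ), Integrable (fun ω => Real.exp (u * X k ω)) P) :
    (fun k l => mixedPartial l (fun z => columnCgf A X P z k) 0) = cumulantSeq A X P := by
  funext k l
  have hsum : ∑ m, A m k * (0 : Fin n → ℝ) m = 0 := by simp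
  have hcgf : ContDiffAt ℝ (⊤ : ℕ∞) (cgf (X k) P) (∑ m, A m k * (0 : Fin n → ℝ) m) :=
    hsum ▸ contDiffAt_cgf_zero (hX k)
  simp only [columnCgf, mixedPartial_comp_linear hcgf, hsum, cumulantSeq, cumulant]

theorem eventually_integrable_and_finiteMGFAt_columnCgf [IsProbabilityMeasure P]
    {τ : Ω → Fin d → ℝ}
    (hX : ∀ k, ∀ᶠ u in 𝓝 (0 : ℝ), Integrable (fun ω => Real.exp (u * X k ω)) P)
    (hτ : ∀ᶠ x in 𝓝 (0 : Fin d → ℝ), FiniteMGFAt τ P x) :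
    ∀ᶠ z in 𝓝 (0 : Fin n → ℝ),
      (∀ k, Integrable (fun ω => Real.exp ((∑ m, A m k * z m) * X k ω)) P) ∧
        FiniteMGFAt τ P (columnCgf A X P z) := by
  have hlin (k : Fin d) : Tendsto (fun z : Fin n → ℝ => ∑ m, A m k * z m) (𝓝 0) (𝓝 0) :=
    Continuous.tendsto' (by fun_prop) _ _ (by simp)
  have hcgf : Tendsto (columnCgf A X P) (𝓝 0) (𝓝 0) := by
    simpa only [columnCgf_zero] using (contDiffAt_columnCgf_zero A hX).continuousAt.tendsto
  exact (eventually_all.2 fun k => (hlin k).eventually (hX k)).and (hcgf.eventually hτ)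

theorem jointCumulant_eq_umbralEval [IsProbabilityMeasure P] {τ : Ω → Fin d → ℝ}
    {Y : Ω → Fin n → ℝ} (hτ : Measurable τ)
    (hτfin : ∀ᶠ x in 𝓝 (0 : Fin d → ℝ), FiniteMGFAt τ P x)
    (hX : ∀ k, ∀ᶠ u in 𝓝 (0 : ℝ), Integrable (fun ω => Real.exp (u * X k ω)) P)
    (hY : jointCgf Y P =ᶠ[𝓝 0] jointCgf τ P ∘ columnCgf A X P) (i : Fin n →₀ ℕ) :
    jointCumulant Y P i = umbralEval τ P (bellPolynomial (cumulantSeq A X P) i) := by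
  have hzero := columnCgf_zero (P := P) A X
  have hK : ContDiffAt ℝ (⊤ : ℕ∞) (jointCgf τ P) (columnCgf A X P 0) :=
    hzero ▸ (analyticAt_jointCgf hτ hτfin).contDiffAt
  rw [jointCumulant, mixedPartial_congr hY, mixedPartial_comp hK (contDiffAt_columnCgf_zero A hX),
    mixedPartial_columnCgf_zero A hX, hzero]
  rfl

end LinearImage

end Subordination

end SubLevy

end

open SubLevy in
theorem theorem1_general {Ω : Type*} [MeasurableSpace Ω] (P : Measure Ω) [IsProbabilityMeasure P]
    (n d : ℕ) (A : Matrix (Fin n) (Fin d) ℝ) (Z : Fin d → ℝ≥0 → Ω → ℝ) (τ : Ω → Fin d → ℝ)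
    (hZ : ∀ k, IsLevyProcess (Z k) P) (hZindep : iIndepFun (fun k ω t => Z k t ω) P)
    (hτ : Measurable τ) (hτ0 : ∀ᵐ ω ∂P, ∀ k, 0 ≤ τ ω k)
    (hZτ : IndepFun (fun ω k t => Z k t ω) τ P)
    (hZmgf : ∀ k, ∀ᶠ u in 𝓝 (0 : ℝ), Integrable (fun ω => Real.exp (u * Z k 1 ω)) P)
    (hτmgf : ∀ᶠ x in 𝓝 (0 : Fin d → ℝ), FiniteMGFAt τ P x) :
    (∀ᶠ z in 𝓝 (0 : Fin n → ℝ), FiniteMGFAt (fun ω => A.mulVec (timeChange Z τ ω)) P z) ∧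
    (∀ z : Fin n → ℝ, (∀ k, Integrable (fun ω => Real.exp ((∑ m, A m k * z m) * Z k 1 ω)) P) →
      FiniteMGFAt τ P (columnCgf A (fun k => Z k 1) P z) →
      FiniteMGFAt (fun ω => A.mulVec (timeChange Z τ ω)) P z ∧
      jointCgf (fun ω => A.mulVec (timeChange Z τ ω)) P z =
        jointCgf τ P (columnCgf A (fun k => Z k 1) P z)) ∧
    ∀ i : Fin n →₀ ℕ, jointCumulant (fun ω => A.mulVec (timeChange Z τ ω)) P i =
      umbralEval τ P (bellPolynomial (cumulantSeq A (fun k => Z k 1) P) i) := by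
  have hmain (z : Fin n → ℝ)
      (hu : ∀ k, Integrable (fun ω => Real.exp ((∑ m, A m k * z m) * Z k 1 ω)) P)
      (hfin : FiniteMGFAt τ P (columnCgf A (fun k => Z k 1) P z)) :
      FiniteMGFAt (fun ω => A.mulVec (timeChange Z τ ω)) P z ∧
        jointCgf (fun ω => A.mulVec (timeChange Z τ ω)) P z =
          jointCgf τ P (columnCgf A (fun k => Z k 1) P z) := by
    rw [finiteMGFAt_mulVec, jointCgf_mulVec]
    exact finiteMGFAt_timeChange_and_jointCgf_eq hZ hZindep hτ hτ0 hZτ hu hfin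
  have hnear := eventually_integrable_and_finiteMGFAt_columnCgf A hZmgf hτmgf
  exact ⟨hnear.mono fun z hz => (hmain z hz.1 hz.2).1, hmain,
    jointCumulant_eq_umbralEval A hτ hτmgf hZmgf (hnear.mono fun z hz => (hmain z hz.1 hz.2).2)⟩

theorem theorem1 {Ω : Type*} [MeasurableSpace Ω] (P : Measure Ω) [IsProbabilityMeasure P]
    (n d : ℕ) (A : Matrix (Fin n) (Fin d) ℝ)
    (Z : Fin d → ℝ≥0 → Ω → ℝ) (T : ℝ≥0 → Ω → (Fin d → ℝ))
    -- the components of `Z` are independent Lévy processes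
    (hZ : ∀ k, SubLevy.IsLevyProcess (Z k) P)
    (hZindep : iIndepFun (fun k ω t => Z k t ω) P)
    -- `T` is a subordinator independent of `Z`
    (hT : SubLevy.IsSubordinator T P)
    (hZT : IndepFun (fun ω k t => Z k t ω) (fun ω t => T t ω) P)
    -- `Z_k(1)` and `T(1)` have a moment generating function near the origin
    (hZmgf : ∀ k, ∀ᶠ u in 𝓝 (0 : ℝ), Integrable (fun ω => Real.exp (u * Z k 1 ω)) P)
    (hTmgf : ∀ᶠ z in 𝓝 (0 : Fin d → ℝ), SubLevy.FiniteMGFAt (T 1) P z) :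
    -- so has `Y(1)`
    (∀ᶠ z in 𝓝 (0 : Fin n → ℝ), SubLevy.FiniteMGFAt (SubLevy.subordinated A Z T 1) P z) ∧
    -- `K_Y` is the composed cumulant generating function wherever the latter is defined
    (∀ z : Fin n → ℝ,
      (∀ k, Integrable (fun ω => Real.exp ((∑ m, A m k * z m) * Z k 1 ω)) P) →
      SubLevy.FiniteMGFAt (T 1) P (fun k => cgf (Z k 1) P (∑ m, A m k * z m)) →
      SubLevy.FiniteMGFAt (SubLevy.subordinated A Z T 1) P z ∧
      SubLevy.jointCgf (SubLevy.subordinated A Z T 1) P z =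
        SubLevy.jointCgf (T 1) P (fun k => cgf (Z k 1) P (∑ m, A m k * z m))) ∧
    -- the joint cumulants of `Y(1)`
    (∀ i : Fin n →₀ ℕ,
      SubLevy.jointCumulant (SubLevy.subordinated A Z T 1) P i =
        SubLevy.umbralEval (T 1) P
          (SubLevy.bellPolynomial (SubLevy.cumulantSeq A (fun k => Z k 1) P) i)) :=
  theorem1_general P n d A Z (T 1) hZ hZindep (hT.isLevy.measurable 1) (hT.ae_nonneg 1)
    (hZT.comp measurable_id (measurable_pi_apply 1)) hZmgf hTmgf
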